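/- A spherical Lambert cube $L(a,b,c)$ is a convex polytope in the unit sphere $\mathbb S^3\subset\mathbb R^4$ of the combinatorial type of a cube, whose dihedral angles along three pairwise disjoint edges, no two of which are parallel in the combinatorial cube, are $a,b,c$ (the essential angles), and whose other nine dihedral angles are all equal to $\pi/2$. Among the spherical Lambert cubes $L(a,b,c)$ with $a,b,c\in\pi\mathbb Q$ and $\cos^2 a+\cos^2 b+\cos^2 c=1$ there are, up to permutation of the essential angles and up to isometry of $\mathbb S^3$, exactly two: $$L_1=L\left(\tfrac{3\pi}{4},\tfrac{2\pi}{3},\tfrac{2\pi}{3}\right),\qquad L_2=L\left(\tfrac{2\pi}{3},\tfrac{3\pi}{5},\tfrac{4\pi}{5}\right).$$ Both exist, they are not isometric, and their volumes are $\operatorname{Vol}L_1=\tfrac{31}{576}\pi^2$ and $\operatorname{Vol}L_2=\tfrac{17}{360}\pi^2$, where $\operatorname{Vol}\mathbb S^3=2\pi^2$. In particular there is no nonconstant continuous family of such cubes: if $t\mapsto(a(t),b(t),c(t))$ is continuous on an interval $[t_0,t_1]$, $t_0<t_1$, and for every $t\in[t_0,t_1]\cap\pi\mathbb Q$ there is a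 spherical Lambert cube $L(a(t),b(t),c(t))$ with $a(t),b(t),c(t)\in\pi\mathbb Q$ and $\cos^2a(t)+\cos^2b(t)+\cos^2c(t)=1$, then $(a(t),b(t),c(t))$ is constant on $[t_0,t_1]$. -/

import Mathlib

open MeasureTheory

/-- The set of labels of the six facets of the combinatorial cube `[-1, 1]³`: the label `(i, true)`
stands for the facet `xᵢ = 1` and `(i, false)` for the opposite facet `xᵢ = -1`. -/
abbrev CubeFacet : Type := Fin 3 × Bool

/-- The intersection of the unit sphere `S³ ⊂ ℝ⁴` with the polyhedral cone whose outward normals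
are the vectors `u f`. -/
def sphericalPolyhedron (u : CubeFacet → EuclideanSpace ℝ (Fin 4)) :
    Set (EuclideanSpace ℝ (Fin 4)) :=
  {x | x ∈ Metric.sphere (0 : EuclideanSpace ℝ (Fin 4)) 1 ∧ ∀ f, inner ℝ (u f) x ≤ 0}

/-- The face of `sphericalPolyhedron u` cut out by the bounding hyperplanes with label in `S`. -/
def sphericalFace (u : CubeFacet → EuclideanSpace ℝ (Fin 4)) (S : Set CubeFacet) :
    Set (EuclideanSpace ℝ (Fin 4)) :=
  {x | x ∈ sphericalPolyhedron u ∧ ∀ f ∈ S, inner ℝ (u f) x = 0}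

/-- `P ⊂ S³` is a spherical polytope of the combinatorial type of a cube, with outward unit facet
normals `u`: a collection of facets of `P` has a common point if and only if the corresponding
facets of the standard cube have a common vertex (the vertices of the standard cube are the sign
vectors `ε`, and the facets through `ε` are the `(i, ε i)`).

This condition says that `P` has the face lattice of a cube. The bounding hyperplanes
through a vertex of `P` are then exactly three, one from each opposite pair, and every such choice
gives exactly one vertex. It also contains nondegeneracy: opposite facets being nonempty and
disjoint, no bounding hyperplane contains `P`, so `P` has nonempty interior in `S³`; and `P`
contains no pair of antipodal points, as these would lie on all six facets. -/
structure IsSphericalCube (u : CubeFacet → EuclideanSpace ℝ (Fin 4))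
    (P : Set (EuclideanSpace ℝ (Fin 4))) : Prop where
  norm_normal : ∀ f, ‖u f‖ = 1
  eq_polyhedron : P = sphericalPolyhedron u
  face_nonempty_iff : ∀ S : Set CubeFacet,
    (sphericalFace u S).Nonempty ↔ ∃ ε : Fin 3 → Bool, ∀ f ∈ S, ε f.1 = f.2

/-- The interior dihedral angle between two facets with given outward normals. -/
noncomputable def dihedralAngle (n m : EuclideanSpace ℝ (Fin 4)) : ℝ :=
  Real.pi - InnerProductGeometry.angle n m

/-- `P` is a spherical Lambert cube `L(a, b, c)`: a spherical polytope of the combinatorial type of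
a cube, with dihedral angles `a`, `b`, `c` (the essential angles) along three pairwise disjoint
edges, no two of them parallel in the standard cube, and dihedral angle `π / 2` along the other
nine edges. The essential edges are those where the facets `xᵢ = 1` and `xᵢ₊₁ = -1` meet, with
`i` modulo `3`; all other choices of such a triple of edges arise from this one by relabelling. -/
def IsLambertCube (a b c : ℝ) (P : Set (EuclideanSpace ℝ (Fin 4))) : Prop :=
  ∃ u : CubeFacet → EuclideanSpace ℝ (Fin 4), IsSphericalCube u P ∧
    ∀ (i : Fin 3) (s t : Bool), dihedralAngle (u (i, s)) (u (i + 1, t)) =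
      if s = true ∧ t = false then ![a, b, c] i else Real.pi / 2

/-- An angle is rational if it is a rational multiple of `π`. -/
def IsRationalAngle (x : ℝ) : Prop := ∃ q : ℚ, x = q * Real.pi

/-- `P` is a spherical Lambert cube `L(a, b, c)` with rational essential angles such that
`cos² a + cos² b + cos² c = 1`. -/
def IsRationalPythagoreanLambertCube (a b c : ℝ) (P : Set (EuclideanSpace ℝ (Fin 4))) : Prop :=
  IsLambertCube a b c P ∧ IsRationalAngle a ∧ IsRationalAngle b ∧ IsRationalAngle c ∧
    Real.cos a ^ 2 + Real.cos b ^ 2 + Real.cos c ^ 2 = 1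

/-- Congruence by an isometry of `S³`, that is, by an orthogonal transformation of `ℝ⁴`. -/
def SphericallyCongruent (P Q : Set (EuclideanSpace ℝ (Fin 4))) : Prop :=
  ∃ g : EuclideanSpace ℝ (Fin 4) ≃ₗᵢ[ℝ] EuclideanSpace ℝ (Fin 4), g '' P = Q

/-- The three-dimensional volume of `P ⊂ S³`, for the standard surface measure on the unit sphere
(of total mass `2π²`). -/
noncomputable def sphericalVolume (P : Set (EuclideanSpace ℝ (Fin 4))) : ENNReal :=
  (volume : Measure (EuclideanSpace ℝ (Fin 4))).toSphere (Subtype.val ⁻¹' P)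

/-!
*Angles.* Since `∑ cos² θᵢ = 1` means `∑ cos 2θᵢ = -1`, one takes normalized traces over `ℚ`. The
trace of the cosine attached to a root of unity of order `n` is `μ(n) / φ(n)`, which is `-1/2` for
`n = 3`, `-1/4` for `n = 5` and at least `-1/6` for every other `n > 2`; three such values add up to
`-1` only if one of the orders is `3`, and then the other two angles have orders `3` and `4`, or `5`
and `5`.

*Existence and rigidity.* The vertex on the facets `(i, false)` and the normals of these facets form
an orthonormal frame. Its products with the other three normals satisfy cyclic relations whose only
solution is explicit, so that the cube is congruent to a standard one, and its angles are obtuse.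

*Volume.* Put `κᵢ = -cos θᵢ`. Multiplication of quaternions by the imaginary unit with coordinates
`κᵢ` carries the normals `u (i + 1, true)` to the normals `u (i, false)`. Hence the indicator
function of the cone over the standard cube, summed over the four powers of this rotation, is a
constant plus a combination of products of two or four signs of linear forms. The integral of such
a product over the unit ball of `ℝ⁴ = ℝ² × ℝ²` splits into means over two circles.

*Families.* A continuous map which takes finitely many values on a dense subset of an interval is
constant.
-/

open scoped Real

local notation "ℝ⁴" => EuclideanSpace ℝ (Fin 4)

section CyclotomicTrace

open Polynomial

theorem nextCoeff_X_pow_sub_one (R : Type*) [CommRing R] [Nontrivial R] {n : ℕ} (hn : 0 < n) :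
    (X ^ n - 1 : R[X]).nextCoeff = if n = 1 then -1 else 0 := by
  have hdeg : (X ^ n - 1 : R[X]).natDegree = n := natDegree_X_pow_sub_C (r := (1 : R))
  rw [nextCoeff_of_natDegree_pos (by omega), hdeg, coeff_sub, coeff_X_pow, coeff_one]
  split_ifs <;> first | omega | simp

theorem nextCoeff_cyclotomic (R : Type*) [CommRing R] [Nontrivial R] {n : ℕ} (hn : 0 < n) :
    (cyclotomic n R).nextCoeff = -(ArithmeticFunction.moebius n : R) := by
  have hsum : ∀ m > 0, ∑ d ∈ m.divisors, (cyclotomic d R).nextCoeff =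
      if m = 1 then (-1 : R) else 0 := fun m hm => by
    rw [← Monic.nextCoeff_prod _ _ fun d _ => cyclotomic.monic d R,
      prod_cyclotomic_eq_X_pow_sub_one hm, nextCoeff_X_pow_sub_one R hm]
  rw [← ArithmeticFunction.sum_eq_iff_sum_mul_moebius_eq.1 hsum n hn,
    Finset.sum_eq_single (n, 1)]
  · simp
  · rintro ⟨d, e⟩ hde hne
    obtain ⟨rfl, -⟩ := Nat.mem_divisorsAntidiagonal.1 hde
    rw [if_neg, mul_zero]
    rintro rfl
    simp at hne
  · simp [hn.ne']

theorem normalizedTrace_of_isPrimitiveRoot {K : Type*} [Field K] [CharZero K]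
    [Algebra.IsIntegral ℚ K] {ζ : K} {n : ℕ} (hn : 0 < n) (h : IsPrimitiveRoot ζ n) :
    Algebra.normalizedTrace ℚ K ζ = (ArithmeticFunction.moebius n : ℚ) / n.totient := by
  rw [Algebra.normalizedTrace_minpoly, ← cyclotomic_eq_minpoly_rat h hn, natDegree_cyclotomic,
    nextCoeff_cyclotomic ℚ hn, neg_neg, smul_eq_mul, inv_mul_eq_div]

instance isIntegral_rat_algebraicClosure : Algebra.IsIntegral ℚ (algebraicClosure ℚ ℂ) := by
  have h := (algebraicClosure.isAlgebraic ℚ ℂ).isIntegral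
  rwa [Subsingleton.elim (algebraicClosure ℚ ℂ).algebra' DivisionRing.toRatAlgebra] at h

theorem exists_isPrimitiveRoot_den (q : ℚ) : ∃ ζ : algebraicClosure ℚ ℂ,
    IsPrimitiveRoot ζ q.den ∧ (ζ : ℂ) = Complex.exp (2 * π * Complex.I * q) := by
  have hroot := Complex.isPrimitiveRoot_exp_rat q
  have halg := (hroot.isIntegral q.den_pos).tower_top (A := ℚ) |>.isAlgebraic
  exact ⟨⟨_, mem_algebraicClosure_iff.2 halg⟩,
    hroot.of_map_of_injective (f := (algebraicClosure ℚ ℂ).val) Subtype.val_injective, rfl⟩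

/-- The normalized trace over `ℚ` of the algebraic number `cos (2 q π)`, namely `μ(n) / φ(n)` for
the order `n` of the root of unity `exp (2 q π i)`, which is the denominator of `q`. -/
noncomputable def cosTrace (q : ℚ) : ℚ :=
  (ArithmeticFunction.moebius q.den : ℚ) / q.den.totient

theorem exists_coe_eq_cos_and_normalizedTrace_eq (q : ℚ) : ∃ x : algebraicClosure ℚ ℂ,
    (x : ℂ) = (Real.cos (2 * (q * π)) : ℂ) ∧
      Algebra.normalizedTrace ℚ (algebraicClosure ℚ ℂ) x = cosTrace q := by
  obtain ⟨ζ, hζ, hexp⟩ := exists_isPrimitiveRoot_den q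
  refine ⟨(2⁻¹ : ℚ) • (ζ + ζ⁻¹), ?_, ?_⟩
  · rw [IntermediateField.coe_smul, IntermediateField.coe_add, IntermediateField.coe_inv, hexp,
      ← Complex.exp_neg, Complex.ofReal_cos, Complex.cos, Rat.smul_def]
    push_cast
    ring_nf
  · rw [map_smul, map_add, normalizedTrace_of_isPrimitiveRoot q.den_pos hζ,
      normalizedTrace_of_isPrimitiveRoot q.den_pos hζ.inv, smul_eq_mul, cosTrace]
    ring

theorem sum_cosTrace_eq {ι : Type*} {s : Finset ι} {q : ι → ℚ} {r : ℚ}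
    (h : ∑ i ∈ s, Real.cos (2 * (q i * π)) = r) :
    ∑ i ∈ s, cosTrace (q i) = r := by
  choose x hcos htrace using exists_coe_eq_cos_and_normalizedTrace_eq
  have hsum : ∑ i ∈ s, x (q i) = algebraMap ℚ (algebraicClosure ℚ ℂ) r := by
    apply Subtype.val_injective
    have hcast : ∑ i ∈ s, (Real.cos (2 * (q i * π)) : ℂ) = ((r : ℝ) : ℂ) := by exact_mod_cast h
    simpa [hcos] using hcast
  have := congrArg (Algebra.normalizedTrace ℚ (algebraicClosure ℚ ℂ)) hsum
  simpa only [map_sum, htrace, Algebra.normalizedTrace_algebraMap_apply,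
    Algebra.normalizedTrace_self_apply] using this

end CyclotomicTrace

section MoebiusOverTotient

theorem dvd_thirty_of_squarefree_of_totient_lt_six {n : ℕ} (hn : Squarefree n)
    (h : n.totient < 6) : n ∣ 30 := by
  have hprime : n.primeFactors ⊆ {2, 3, 5} := fun p hp => by
    have hpp := Nat.prime_of_mem_primeFactors hp
    have hdvd := Nat.totient_dvd_of_dvd (Nat.dvd_of_mem_primeFactors hp)
    have hle := Nat.le_of_dvd (Nat.totient_pos.2 (Nat.pos_of_ne_zero hn.ne_zero)) hdvd
    rw [Nat.totient_prime hpp] at hle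
    have : p ≤ 6 := by omega
    interval_cases p <;> first | decide | exact absurd hpp (by decide)
  rw [← Nat.prod_primeFactors_of_squarefree hn]
  exact (Finset.prod_dvd_prod_of_subset _ _ _ hprime).trans (by decide)

theorem moebius_mul_of_prime_of_prime {p q : ℕ} (hp : p.Prime) (hq : q.Prime) (hpq : p ≠ q) :
    ArithmeticFunction.moebius (p * q) = 1 := by
  rw [ArithmeticFunction.isMultiplicative_moebius.map_mul_of_coprime
    ((Nat.coprime_primes hp hq).2 hpq), ArithmeticFunction.moebius_apply_prime hp,
    ArithmeticFunction.moebius_apply_prime hq]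
  norm_num

theorem eq_three_or_eq_five_or_le_moebius_div_totient {n : ℕ} (hn : 2 < n) :
    n = 3 ∨ n = 5 ∨ -(1 / 6 : ℚ) ≤ (ArithmeticFunction.moebius n : ℚ) / n.totient := by
  by_cases hsq : Squarefree n
  swap
  · right; right
    rw [ArithmeticFunction.moebius_eq_zero_of_not_squarefree hsq]
    norm_num
  rcases le_or_gt 6 n.totient with hlarge | hsmall
  · right; right
    have hmoebius : (-1 : ℚ) ≤ ArithmeticFunction.moebius n := by
      exact_mod_cast (abs_le.1 ArithmeticFunction.abs_moebius_le_one).1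
    have hlarge' : (6 : ℚ) ≤ n.totient := by exact_mod_cast hlarge
    rw [le_div_iff₀ (by linarith)]
    linarith
  · have hmem : n ∈ Nat.divisors 30 :=
      Nat.mem_divisors.2 ⟨dvd_thirty_of_squarefree_of_totient_lt_six hsq hsmall, by norm_num⟩
    have hdiv : Nat.divisors 30 = {1, 2, 3, 5, 2 * 3, 2 * 5, 15, 30} := by decide
    have h15 : Nat.totient 15 = 8 := by decide
    have h30 : Nat.totient 30 = 8 := by decide
    rw [hdiv] at hmem
    simp only [Finset.mem_insert, Finset.mem_singleton] at hmem
    rcases hmem with rfl | rfl | rfl | rfl | rfl | rfl | rfl | rfl <;> try omega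
    all_goals
      right; right
      rw [moebius_mul_of_prime_of_prime (by norm_num) (by norm_num) (by norm_num)]
      exact le_trans (by norm_num) (show (0 : ℚ) ≤ _ by positivity)

end MoebiusOverTotient

section RationalAngles

theorem cosTrace_cases {q : ℚ} (hq : q ∈ Set.Ioo (1 / 2 : ℚ) 1) :
    (q = 2 / 3 ∧ cosTrace q = -1 / 2) ∨
      ((q = 3 / 5 ∨ q = 4 / 5) ∧ cosTrace q = -1 / 4) ∨ -(1 / 6) ≤ cosTrace q := by
  have hden : 0 < (q.den : ℚ) := by exact_mod_cast q.den_pos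
  have hq_eq : q = q.num / q.den := (Rat.num_div_den q).symm
  have hlow : (q.den : ℤ) < 2 * q.num := by
    have := hq.1
    rw [hq_eq, div_lt_div_iff₀ two_pos hden] at this
    exact_mod_cast (by linarith : (q.den : ℚ) < 2 * q.num)
  have hhigh : q.num < (q.den : ℤ) := by
    have := hq.2
    rw [hq_eq, div_lt_one hden] at this
    exact_mod_cast this
  rcases eq_three_or_eq_five_or_le_moebius_div_totient (n := q.den) (by omega) with h | h | h
  · have hnum : q.num = 2 := by omega
    rw [hnum, h] at hq_eq
    refine Or.inl ⟨by rw [hq_eq]; norm_num, ?_⟩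
    rw [cosTrace, h, ArithmeticFunction.moebius_apply_prime (by norm_num),
      Nat.totient_prime (by norm_num)]
    norm_num
  · have hnum : q.num = 3 ∨ q.num = 4 := by omega
    refine Or.inr (Or.inl ⟨?_, ?_⟩)
    · exact hnum.imp (fun h' => by rw [hq_eq, h', h]; norm_num)
        (fun h' => by rw [hq_eq, h', h]; norm_num)
    · rw [cosTrace, h, ArithmeticFunction.moebius_apply_prime (by norm_num),
        Nat.totient_prime (by norm_num)]
      norm_num
  · exact Or.inr (Or.inr h)

theorem cos_two_mul_pi_div_three : Real.cos (2 * π / 3) = -(1 / 2) := by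
  rw [show 2 * π / 3 = π - π / 3 by ring, Real.cos_pi_sub, Real.cos_pi_div_three]

theorem cos_three_mul_pi_div_four : Real.cos (3 * π / 4) = -(√2 / 2) := by
  rw [show 3 * π / 4 = π - π / 4 by ring, Real.cos_pi_sub, Real.cos_pi_div_four]

theorem cos_four_mul_pi_div_five : Real.cos (4 * π / 5) = -((1 + √5) / 4) := by
  rw [show 4 * π / 5 = π - π / 5 by ring, Real.cos_pi_sub, Real.cos_pi_div_five]

theorem cos_three_mul_pi_div_five : Real.cos (3 * π / 5) = -((√5 - 1) / 4) := by
  rw [show 3 * π / 5 = π - 2 * (π / 5) by ring, Real.cos_pi_sub, Real.cos_two_mul,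
    Real.cos_pi_div_five]
  linear_combination (-1 / 8) * Real.sq_sqrt (show (0 : ℝ) ≤ 5 by norm_num)

theorem eq_three_mul_pi_div_four_of_cos_sq {a : ℝ} (ha : a ∈ Set.Ioo (π / 2) π)
    (h : Real.cos a ^ 2 = 1 / 2) : a = 3 * π / 4 := by
  have hneg : Real.cos a < 0 := Real.cos_neg_of_pi_div_two_lt_of_lt ha.1 (by linarith [ha.1, ha.2])
  apply Real.injOn_cos ⟨by linarith [Real.pi_pos, ha.1], ha.2.le⟩
    ⟨by positivity, by linarith [Real.pi_pos]⟩
  rw [cos_three_mul_pi_div_four]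
  have hsq : √2 ^ 2 = 2 := Real.sq_sqrt (by norm_num)
  nlinarith [Real.sqrt_nonneg 2]

theorem pair_eq_of_cos_sq_add_cos_sq {b c : ℝ} (hb : b = 3 * π / 5 ∨ b = 4 * π / 5)
    (hc : c = 3 * π / 5 ∨ c = 4 * π / 5) (h : Real.cos b ^ 2 + Real.cos c ^ 2 = 3 / 4) :
    ({b, c} : Multiset ℝ) = {3 * π / 5, 4 * π / 5} := by
  have hsq : √5 ^ 2 = 5 := Real.sq_sqrt (by norm_num)
  have hlow : 2 < √5 := by rw [Real.lt_sqrt] <;> norm_num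
  have hhigh : √5 < 3 := by rw [Real.sqrt_lt] <;> norm_num
  rcases hb with rfl | rfl <;> rcases hc with rfl | rfl
  · rw [cos_three_mul_pi_div_five] at h
    nlinarith
  · rfl
  · exact Multiset.pair_comm _ _
  · rw [cos_four_mul_pi_div_five] at h
    nlinarith

theorem cosTrace_add_add_eq {p q r : ℚ}
    (h : Real.cos (p * π) ^ 2 + Real.cos (q * π) ^ 2 + Real.cos (r * π) ^ 2 = 1) :
    cosTrace p + cosTrace q + cosTrace r = -1 := by
  have hcos : ∑ i, Real.cos (2 * (![p, q, r] i * π)) = ((-1 : ℚ) : ℝ) := by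
    rw [Fin.sum_univ_three, Real.cos_two_mul, Real.cos_two_mul, Real.cos_two_mul]
    push_cast
    linear_combination 2 * h
  simpa [Fin.sum_univ_three] using sum_cosTrace_eq hcos

theorem IsRationalAngle.exists_mem_Ioo {a : ℝ} (ha : IsRationalAngle a)
    (hobtuse : a ∈ Set.Ioo (π / 2) π) : ∃ q ∈ Set.Ioo (1 / 2 : ℚ) 1, a = q * π := by
  obtain ⟨q, rfl⟩ := ha
  have hlow : (1 / 2 : ℝ) < q := by nlinarith [hobtuse.1, Real.pi_pos]
  have hhigh : (q : ℝ) < 1 := by nlinarith [hobtuse.2, Real.pi_pos]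
  exact ⟨q, ⟨(Rat.cast_lt (K := ℝ)).1 (by simpa using hlow), by exact_mod_cast hhigh⟩, rfl⟩

theorem pair_cases_of_cosTrace_add {q r : ℚ} (hq : q ∈ Set.Ioo (1 / 2 : ℚ) 1)
    (hr : r ∈ Set.Ioo (1 / 2 : ℚ) 1) (htrace : cosTrace q + cosTrace r = -1 / 2)
    (hcos : Real.cos (q * π) ^ 2 + Real.cos (r * π) ^ 2 = 3 / 4) :
    ({(q * π : ℝ), (r * π : ℝ)} : Multiset ℝ) = {2 * π / 3, 3 * π / 4} ∨
      ({(q * π : ℝ), (r * π : ℝ)} : Multiset ℝ) = {3 * π / 5, 4 * π / 5} := by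
  have hobtuse {s : ℚ} (hs : s ∈ Set.Ioo (1 / 2 : ℚ) 1) : (s * π : ℝ) ∈ Set.Ioo (π / 2) π := by
    have hlow : (1 / 2 : ℝ) < s := by simpa using (Rat.cast_lt (K := ℝ)).2 hs.1
    have hhigh : (s : ℝ) < 1 := by exact_mod_cast hs.2
    exact ⟨by nlinarith [Real.pi_pos], by nlinarith [Real.pi_pos]⟩
  have hthird : ((2 / 3 : ℚ) * π : ℝ) = 2 * π / 3 := by push_cast; ring
  have hcos_third : Real.cos (2 * π / 3) ^ 2 = 1 / 4 := by
    rw [cos_two_mul_pi_div_three]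
    norm_num
  have hfifth {s : ℚ} (hs : s = 3 / 5 ∨ s = 4 / 5) :
      (s * π : ℝ) = 3 * π / 5 ∨ (s * π : ℝ) = 4 * π / 5 := by
    rcases hs with rfl | rfl
    · exact Or.inl (by push_cast; ring)
    · exact Or.inr (by push_cast; ring)
  rcases cosTrace_cases hq with ⟨rfl, hq'⟩ | ⟨hq5, hq'⟩ | hq'
  · rw [hthird, hcos_third] at hcos
    rw [hthird, eq_three_mul_pi_div_four_of_cos_sq (hobtuse hr) (by linarith)]
    exact Or.inl rfl
  all_goals rcases cosTrace_cases hr with ⟨rfl, hr'⟩ | ⟨hr5, hr'⟩ | hr' <;> try (exfalso; linarith)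
  · exact Or.inr (pair_eq_of_cos_sq_add_cos_sq (hfifth hq5) (hfifth hr5) hcos)
  · rw [hthird, hcos_third] at hcos
    rw [hthird, eq_three_mul_pi_div_four_of_cos_sq (hobtuse hq) (by linarith)]
    exact Or.inl (Multiset.pair_comm _ _)

theorem IsRationalAngle.obtuse_pythagorean_cases {a b c : ℝ} (ha : IsRationalAngle a)
    (hb : IsRationalAngle b) (hc : IsRationalAngle c) (ha' : a ∈ Set.Ioo (π / 2) π)
    (hb' : b ∈ Set.Ioo (π / 2) π) (hc' : c ∈ Set.Ioo (π / 2) π)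
    (h : Real.cos a ^ 2 + Real.cos b ^ 2 + Real.cos c ^ 2 = 1) :
    ({a, b, c} : Multiset ℝ) = {3 * π / 4, 2 * π / 3, 2 * π / 3} ∨
      ({a, b, c} : Multiset ℝ) = {2 * π / 3, 3 * π / 5, 4 * π / 5} := by
  obtain ⟨p, hp, rfl⟩ := ha.exists_mem_Ioo ha'
  obtain ⟨q, hq, rfl⟩ := hb.exists_mem_Ioo hb'
  obtain ⟨r, hr, rfl⟩ := hc.exists_mem_Ioo hc'
  have htrace := cosTrace_add_add_eq h
  have hrotate (x y z : ℝ) : ({x, y, z} : Multiset ℝ) = {y, z, x} := by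
    simp only [Multiset.insert_eq_cons, ← Multiset.singleton_add]
    abel
  wlog hthird : p = 2 / 3 ∧ cosTrace p = -1 / 2 generalizing p q r
  · rw [hrotate]
    rcases cosTrace_cases hp with hp' | ⟨-, hp'⟩ | hp'
    · exact absurd hp' hthird
    all_goals
      rcases cosTrace_cases hq with hq' | ⟨-, hq'⟩ | hq'
      · exact this q hq hb hb' r hr hc hc' p hp ha ha' (by linarith) (by linarith) hq'
      all_goals
        rw [hrotate]
        rcases cosTrace_cases hr with hr' | ⟨-, hr'⟩ | hr'
        · exact this r hr hc hc' p hp ha ha' q hq hb hb' (by linarith) (by linarith) hr'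
        all_goals exfalso; linarith
  obtain ⟨rfl, hp'⟩ := hthird
  have hp_eq : ((2 / 3 : ℚ) * π : ℝ) = 2 * π / 3 := by push_cast; ring
  rw [hp_eq, cos_two_mul_pi_div_three] at h
  rw [hp_eq, Multiset.insert_eq_cons]
  rcases pair_cases_of_cosTrace_add hq hr (by linarith) (by linarith) with hpair | hpair
  · rw [hpair]
    exact Or.inl (hrotate _ _ _).symm
  · exact Or.inr (by rw [hpair]; rfl)

end RationalAngles

section DihedralAngle

theorem dihedralAngle_mem_Icc (n m : ℝ⁴) : dihedralAngle n m ∈ Set.Icc 0 π := by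
  have h0 := InnerProductGeometry.angle_nonneg n m
  have hπ := InnerProductGeometry.angle_le_pi n m
  constructor <;> rw [dihedralAngle] <;> linarith

theorem dihedralAngle_eq_iff_inner_eq {n m : ℝ⁴} (hn : ‖n‖ = 1) (hm : ‖m‖ = 1) {θ : ℝ}
    (hθ : θ ∈ Set.Icc 0 π) : dihedralAngle n m = θ ↔ inner ℝ n m = -Real.cos θ := by
  rw [← Real.injOn_cos.eq_iff (dihedralAngle_mem_Icc n m) hθ, dihedralAngle, Real.cos_pi_sub,
    InnerProductGeometry.cos_angle, hn, hm, mul_one, div_one, neg_eq_iff_eq_neg]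

theorem isLambertCube_iff_inner {θ : Fin 3 → ℝ} (hθ : ∀ i, θ i ∈ Set.Icc 0 π) {P : Set ℝ⁴} :
    IsLambertCube (θ 0) (θ 1) (θ 2) P ↔ ∃ u, IsSphericalCube u P ∧ ∀ (i : Fin 3) (s t : Bool),
      inner ℝ (u (i, s)) (u (i + 1, t)) =
        if s = true ∧ t = false then -Real.cos (θ i) else 0 := by
  have hθ_eq : ![θ 0, θ 1, θ 2] = θ := by
    ext i
    fin_cases i <;> rfl
  rw [IsLambertCube, hθ_eq]
  refine exists_congr fun u => and_congr_right fun hu => forall₃_congr fun i s t => ?_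
  split_ifs
  · exact dihedralAngle_eq_iff_inner_eq (hu.norm_normal _) (hu.norm_normal _) (hθ i)
  · rw [dihedralAngle_eq_iff_inner_eq (hu.norm_normal _) (hu.norm_normal _)
      ⟨by positivity, by linarith [Real.pi_pos]⟩, Real.cos_pi_div_two, neg_zero]

end DihedralAngle

section SphericalCube

theorem sphericalFace_nonempty_of_ne_zero {u : CubeFacet → ℝ⁴} {S : Set CubeFacet} {x : ℝ⁴}
    (hx : x ≠ 0) (hcone : ∀ f, inner ℝ (u f) x ≤ 0) (hS : ∀ f ∈ S, inner ℝ (u f) x = 0) :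
    (sphericalFace u S).Nonempty := by
  refine ⟨‖x‖⁻¹ • x, ⟨?_, fun f => ?_⟩, fun f hf => ?_⟩
  · rw [mem_sphere_zero_iff_norm, norm_smul, norm_inv, norm_norm,
      inv_mul_cancel₀ (norm_ne_zero_iff.2 hx)]
  · rw [inner_smul_right]
    exact mul_nonpos_of_nonneg_of_nonpos (by positivity) (hcone f)
  · rw [inner_smul_right, hS f hf, mul_zero]

theorem IsSphericalCube.of_vertices {u : CubeFacet → ℝ⁴} (hnorm : ∀ f, ‖u f‖ = 1)
    (hvertex : ∀ ε : Fin 3 → Bool, ∃ x ≠ 0, (∀ f, inner ℝ (u f) x ≤ 0) ∧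
      ∀ i, inner ℝ (u (i, ε i)) x = 0)
    (hdisjoint : ∀ x, (∀ f, inner ℝ (u f) x ≤ 0) → ∀ i, inner ℝ (u (i, true)) x = 0 →
      inner ℝ (u (i, false)) x = 0 → x = 0) :
    IsSphericalCube u (sphericalPolyhedron u) := by
  refine ⟨hnorm, rfl, fun S => ⟨?_, ?_⟩⟩
  · rintro ⟨x, ⟨hx, hcone⟩, hS⟩
    have hopp : ∀ i, (i, true) ∈ S → (i, false) ∉ S := fun i htrue hfalse =>
      ne_zero_of_mem_unit_sphere ⟨x, hx⟩ (hdisjoint x hcone i (hS _ htrue) (hS _ hfalse))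
    classical
    refine ⟨fun i => decide ((i, true) ∈ S), ?_⟩
    rintro ⟨i, s⟩ hf
    cases s
    · exact decide_eq_false fun h => hopp i h hf
    · exact decide_eq_true hf
  · rintro ⟨ε, hε⟩
    obtain ⟨x, hx, hcone, hzero⟩ := hvertex ε
    refine sphericalFace_nonempty_of_ne_zero hx hcone fun ⟨i, s⟩ hf => ?_
    obtain rfl : ε i = s := hε _ hf
    exact hzero i

end SphericalCube

section StandardCube

/-- Outward facet normals of the standard Lambert cube whose `i`-th essential angle has cosine
`-κ i`. The facets `(i, false)` lie in the first three coordinate hyperplanes of `ℝ⁴`. -/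
noncomputable def lambertNormal (κ : Fin 3 → ℝ) : CubeFacet → ℝ⁴
  | (i, false) => -EuclideanSpace.single i.castSucc 1
  | (i, true) => κ (i + 1) • EuclideanSpace.single i.castSucc 1 -
      κ i • EuclideanSpace.single (i + 1).castSucc 1 - κ (i + 2) • EuclideanSpace.single 3 1

/-- The vertex of the cone with normals `lambertNormal κ` on the facets `(i, ε i)`, up to scale. -/
noncomputable def lambertVertex (κ : Fin 3 → ℝ) (ε : Fin 3 → Bool) : ℝ⁴ :=
  match ε 0, ε 1, ε 2 with
  | false, false, false => !₂[0, 0, 0, 1]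
  | true, false, false => !₂[κ 2, 0, 0, κ 1]
  | false, true, false => !₂[0, κ 0, 0, κ 2]
  | false, false, true => !₂[0, 0, κ 1, κ 0]
  | true, true, false => !₂[κ 2 ^ 2 + κ 0 ^ 2, κ 0 * κ 1, 0, κ 2 * κ 1]
  | false, true, true => !₂[0, κ 0 ^ 2 + κ 1 ^ 2, κ 1 * κ 2, κ 0 * κ 2]
  | true, false, true => !₂[κ 2 * κ 0, 0, κ 1 ^ 2 + κ 2 ^ 2, κ 1 * κ 0]
  | true, true, true => !₂[κ 0, κ 1, κ 2, 0]

variable {κ : Fin 3 → ℝ}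

theorem inner_lambertNormal_false (κ : Fin 3 → ℝ) (i : Fin 3) (x : ℝ⁴) :
    inner ℝ (lambertNormal κ (i, false)) x = -x i.castSucc := by
  simp [lambertNormal, inner_neg_left, EuclideanSpace.inner_single_left]

theorem inner_lambertNormal_true (κ : Fin 3 → ℝ) (i : Fin 3) (x : ℝ⁴) :
    inner ℝ (lambertNormal κ (i, true)) x =
      κ (i + 1) * x i.castSucc - κ i * x (i + 1).castSucc - κ (i + 2) * x 3 := by
  simp [lambertNormal, inner_sub_left, inner_smul_left, EuclideanSpace.inner_single_left]

theorem norm_lambertNormal (hsum : ∑ i, κ i ^ 2 = 1) (f : CubeFacet) :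
    ‖lambertNormal κ f‖ = 1 := by
  rw [Fin.sum_univ_three] at hsum
  rw [← sq_eq_sq₀ (norm_nonneg _) zero_le_one, ← real_inner_self_eq_norm_sq]
  rcases f with ⟨i, _ | _⟩
  · rw [inner_lambertNormal_false]
    simp [lambertNormal]
  · rw [inner_lambertNormal_true]
    fin_cases i <;> simp [lambertNormal] <;> linarith

theorem inner_lambertNormal_lambertNormal_succ (κ : Fin 3 → ℝ) (i : Fin 3) (s t : Bool) :
    inner ℝ (lambertNormal κ (i, s)) (lambertNormal κ (i + 1, t)) =
      if s = true ∧ t = false then κ i else 0 := by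
  cases s
  · rw [inner_lambertNormal_false]
    fin_cases i <;> cases t <;> simp [lambertNormal]
  · rw [inner_lambertNormal_true]
    fin_cases i <;> cases t <;> simp [lambertNormal] <;> ring

theorem lambertVertex_ne_zero (hκ : ∀ i, 0 < κ i) (ε : Fin 3 → Bool) : lambertVertex κ ε ≠ 0 := by
  intro h
  have hcoord (j : Fin 4) : lambertVertex κ ε j = 0 := by rw [h]; rfl
  have := hcoord 0
  have := hcoord 3
  cases h0 : ε 0 <;> cases h1 : ε 1 <;> cases h2 : ε 2 <;>
    simp_all [lambertVertex, (hκ _).ne']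

theorem inner_lambertNormal_lambertVertex_nonpos (hκ : ∀ i, 0 < κ i) (ε : Fin 3 → Bool)
    (f : CubeFacet) : inner ℝ (lambertNormal κ f) (lambertVertex κ ε) ≤ 0 := by
  have h0 := hκ 0
  have h1 := hκ 1
  have h2 := hκ 2
  rcases f with ⟨i, _ | _⟩
  · rw [inner_lambertNormal_false, Left.neg_nonpos_iff]
    fin_cases i <;> cases hε0 : ε 0 <;> cases hε1 : ε 1 <;> cases hε2 : ε 2 <;>
      simp only [lambertVertex, hε0, hε1, hε2, Fin.zero_eta, Fin.mk_one, Fin.reduceFinMk,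
        Fin.isValue, Fin.castSucc_zero, Fin.castSucc_one,
        Fin.reduceCastSucc, Matrix.cons_val] <;>
      positivity
  · rw [inner_lambertNormal_true]
    fin_cases i <;> cases hε0 : ε 0 <;> cases hε1 : ε 1 <;> cases hε2 : ε 2 <;>
      simp only [lambertVertex, hε0, hε1, hε2, Fin.zero_eta, Fin.mk_one, Fin.reduceFinMk,
        Fin.isValue, zero_add, Fin.reduceAdd, Fin.castSucc_zero, Fin.castSucc_one,
        Fin.reduceCastSucc, Matrix.cons_val] <;>
      rw [← neg_nonneg] <;> ring_nf <;> positivity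

theorem inner_lambertNormal_lambertVertex_eq_zero (κ : Fin 3 → ℝ) (ε : Fin 3 → Bool) (i : Fin 3) :
    inner ℝ (lambertNormal κ (i, ε i)) (lambertVertex κ ε) = 0 := by
  cases hi : ε i
  · rw [inner_lambertNormal_false]
    fin_cases i <;> cases hε0 : ε 0 <;> cases hε1 : ε 1 <;> cases hε2 : ε 2 <;>
      simp_all [lambertVertex]
  · rw [inner_lambertNormal_true]
    fin_cases i <;> cases hε0 : ε 0 <;> cases hε1 : ε 1 <;> cases hε2 : ε 2 <;>
      simp_all [lambertVertex] <;> ring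

theorem apply_three_nonneg (hκ : ∀ i, 0 < κ i) {x : ℝ⁴}
    (hx : ∀ f, inner ℝ (lambertNormal κ f) x ≤ 0) : 0 ≤ x 3 := by
  have hcomb : ∑ i, κ (i + 2) * inner ℝ (lambertNormal κ (i, true)) x =
      -((∑ i, κ i ^ 2) * x 3) := by
    simp only [inner_lambertNormal_true, Fin.sum_univ_three, Fin.isValue, Fin.reduceAdd,
      Fin.castSucc_zero, Fin.castSucc_one, Fin.reduceCastSucc]
    ring
  have hle : -((∑ i, κ i ^ 2) * x 3) ≤ 0 := hcomb ▸ Finset.sum_nonpos fun i _ =>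
    mul_nonpos_of_nonneg_of_nonpos (hκ _).le (hx (i, true))
  have hpos : 0 < ∑ i, κ i ^ 2 := Finset.sum_pos (fun i _ => pow_pos (hκ i) 2) ⟨0, by simp⟩
  exact nonneg_of_mul_nonneg_right (neg_nonpos.1 hle) hpos

theorem eq_zero_of_mem_opposite_facets (hκ : ∀ i, 0 < κ i) {x : ℝ⁴}
    (hx : ∀ f, inner ℝ (lambertNormal κ f) x ≤ 0) {i : Fin 3}
    (htrue : inner ℝ (lambertNormal κ (i, true)) x = 0)
    (hfalse : inner ℝ (lambertNormal κ (i, false)) x = 0) : x = 0 := by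
  have h3 := apply_three_nonneg hκ hx
  have hcoord (j : Fin 3) : 0 ≤ x j.castSucc := by
    have := hx (j, false)
    rwa [inner_lambertNormal_false, Left.neg_nonpos_iff] at this
  have hform := hx (i + 2, true)
  have hcycle : i + 2 + 1 = i := by omega
  have hcycle' : i + 2 + 2 = i + 1 := by omega
  rw [inner_lambertNormal_false, neg_eq_zero] at hfalse
  rw [inner_lambertNormal_true, hfalse] at htrue
  rw [inner_lambertNormal_true, hcycle, hcycle', hfalse] at hform
  have hsum : κ i * x (i + 1).castSucc = 0 ∧ κ (i + 2) * x 3 = 0 :=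
    (add_eq_zero_iff_of_nonneg (mul_nonneg (hκ i).le (hcoord _)) (mul_nonneg (hκ _).le h3)).1
      (by linarith)
  have h1 : x (i + 1).castSucc = 0 := (mul_eq_zero.1 hsum.1).resolve_left (hκ _).ne'
  have h3' : x 3 = 0 := (mul_eq_zero.1 hsum.2).resolve_left (hκ _).ne'
  rw [h3'] at hform
  have h2 : x (i + 2).castSucc = 0 :=
    le_antisymm (nonpos_of_mul_nonpos_right (by linarith : κ i * _ ≤ 0) (hκ i)) (hcoord _)
  ext j
  fin_cases i <;> fin_cases j <;> assumption

theorem isSphericalCube_lambertNormal (hκ : ∀ i, 0 < κ i) (hsum : ∑ i, κ i ^ 2 = 1) :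
    IsSphericalCube (lambertNormal κ) (sphericalPolyhedron (lambertNormal κ)) :=
  .of_vertices (norm_lambertNormal hsum)
    (fun ε => ⟨lambertVertex κ ε, lambertVertex_ne_zero hκ ε,
      inner_lambertNormal_lambertVertex_nonpos hκ ε, inner_lambertNormal_lambertVertex_eq_zero κ ε⟩)
    fun _ hx _ => eq_zero_of_mem_opposite_facets hκ hx

/-- Essential angles of a spherical Lambert cube with `cos² a + cos² b + cos² c = 1`: such angles
are obtuse. -/
structure IsObtusePythagorean (θ : Fin 3 → ℝ) : Prop where
  mem_Ioo : ∀ i, θ i ∈ Set.Ioo (π / 2) π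
  sum_cos_sq : ∑ i, Real.cos (θ i) ^ 2 = 1

/-- The Lambert cube with essential angles `θ` in the position given by `lambertNormal`. -/
noncomputable def standardLambertCube (θ : Fin 3 → ℝ) : Set ℝ⁴ :=
  sphericalPolyhedron (lambertNormal fun i => -Real.cos (θ i))

namespace IsObtusePythagorean

variable {θ : Fin 3 → ℝ}

theorem mem_Icc (hθ : IsObtusePythagorean θ) (i : Fin 3) : θ i ∈ Set.Icc 0 π :=
  ⟨by linarith [(hθ.mem_Ioo i).1, Real.pi_pos], (hθ.mem_Ioo i).2.le⟩

theorem neg_cos_pos (hθ : IsObtusePythagorean θ) (i : Fin 3) : 0 < -Real.cos (θ i) :=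
  neg_pos.2 <| Real.cos_neg_of_pi_div_two_lt_of_lt (hθ.mem_Ioo i).1 <| by
    linarith [(hθ.mem_Ioo i).2, Real.pi_pos]

theorem sum_neg_cos_sq (hθ : IsObtusePythagorean θ) : ∑ i, (-Real.cos (θ i)) ^ 2 = 1 := by
  simpa only [neg_sq] using hθ.sum_cos_sq

theorem isLambertCube_standardLambertCube (hθ : IsObtusePythagorean θ) :
    IsLambertCube (θ 0) (θ 1) (θ 2) (standardLambertCube θ) :=
  (isLambertCube_iff_inner hθ.mem_Icc).2
    ⟨_, isSphericalCube_lambertNormal hθ.neg_cos_pos hθ.sum_neg_cos_sq,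
      inner_lambertNormal_lambertNormal_succ _⟩

end IsObtusePythagorean

end StandardCube

section Congruence

variable {P Q : Set ℝ⁴}

theorem SphericallyCongruent.symm (h : SphericallyCongruent P Q) : SphericallyCongruent Q P := by
  obtain ⟨g, rfl⟩ := h
  exact ⟨g.symm, by simp [Set.image_image]⟩

theorem image_sphericalFace (g : ℝ⁴ ≃ₗᵢ[ℝ] ℝ⁴) (u : CubeFacet → ℝ⁴) (S : Set CubeFacet) :
    g '' sphericalFace u S = sphericalFace (g ∘ u) S := by
  ext x
  obtain ⟨y, rfl⟩ := g.surjective x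
  rw [g.injective.mem_set_image]
  simp [sphericalFace, sphericalPolyhedron]

theorem image_sphericalPolyhedron (g : ℝ⁴ ≃ₗᵢ[ℝ] ℝ⁴) (u : CubeFacet → ℝ⁴) :
    g '' sphericalPolyhedron u = sphericalPolyhedron (g ∘ u) := by
  simpa [sphericalFace] using image_sphericalFace g u ∅

theorem IsSphericalCube.image {u : CubeFacet → ℝ⁴} (h : IsSphericalCube u P)
    (g : ℝ⁴ ≃ₗᵢ[ℝ] ℝ⁴) : IsSphericalCube (g ∘ u) (g '' P) where
  norm_normal f := (g.norm_map _).trans (h.norm_normal f)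
  eq_polyhedron := by rw [h.eq_polyhedron, image_sphericalPolyhedron]
  face_nonempty_iff S := by rw [← image_sphericalFace, Set.image_nonempty, h.face_nonempty_iff]

theorem IsLambertCube.of_congruent {a b c : ℝ} (h : IsLambertCube a b c P)
    (hPQ : SphericallyCongruent P Q) : IsLambertCube a b c Q := by
  obtain ⟨g, rfl⟩ := hPQ
  obtain ⟨u, hu, hangle⟩ := h
  refine ⟨g ∘ u, hu.image g, fun i s t => ?_⟩
  rw [← hangle, dihedralAngle, dihedralAngle]
  exact congrArg _ (g.toLinearIsometry.angle_map _ _)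

end Congruence

section Rigidity

theorem exists_orthonormalBasis_coe_eq {ι E : Type*} [Fintype ι] [Nonempty ι]
    [NormedAddCommGroup E] [InnerProductSpace ℝ E] {v : ι → E} (hv : Orthonormal ℝ v)
    (hcard : Fintype.card ι = Module.finrank ℝ E) : ∃ e : OrthonormalBasis ι ℝ E, ⇑e = v :=
  ⟨(basisOfOrthonormalOfCardEqFinrank hv hcard).toOrthonormalBasis (by simpa using hv), by simp⟩

theorem sum_fin_three_cyclic {M : Type*} [AddCommMonoid M] (f : Fin 3 → M) (i : Fin 3) :
    ∑ j, f j = f i + f (i + 1) + f (i + 2) := by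
  rw [Fin.sum_univ_three]
  fin_cases i
  · rfl
  · exact (add_assoc _ _ _).trans (add_comm _ _)
  · exact (add_comm _ _).trans (add_assoc _ _ _).symm

theorem eq_of_cyclic_mul_add_eq {A x : Fin 3 → ℝ} (hA : ∀ i, 0 < A i) (hx : ∀ i, 0 ≤ x i)
    (h : ∀ i, x i * (A i + x (i + 2)) = A i * (A i + A (i + 2))) : x = A := by
  ext i
  have hpos (j k : Fin 3) : 0 < A j + x k := add_pos_of_pos_of_nonneg (hA j) (hx k)
  have h2 := h (i + 2)
  have h1 := h (i + 1)
  rw [show i + 2 + 2 = i + 1 by omega] at h2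
  rw [show i + 1 + 2 = i by omega] at h1
  -- The relation reads `(x i - A i) * (A i + x (i + 2)) = -(A i * (x (i + 2) - A (i + 2)))`;
  -- going round the cycle, an odd number of signs accumulates.
  have hcycle : (x i - A i) * ((A i + x (i + 2)) * (A (i + 2) + x (i + 1)) * (A (i + 1) + x i) +
      A i * A (i + 2) * A (i + 1)) = 0 := by
    linear_combination (A (i + 2) + x (i + 1)) * (A (i + 1) + x i) * h i -
      A i * (A (i + 1) + x i) * h2 + A i * A (i + 2) * h1
  refine sub_eq_zero.1 ((mul_eq_zero.1 hcycle).resolve_right (ne_of_gt ?_))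
  have := mul_pos (mul_pos (hpos i (i + 2)) (hpos (i + 2) (i + 1))) (hpos (i + 1) i)
  have := mul_pos (mul_pos (hA i) (hA (i + 2))) (hA (i + 1))
  linarith

/-! In a Lambert cube with `∑ i, cos² θᵢ = 1`, let `n` be the vertex on the facets `(i, false)`,
`κᵢ = -cos θᵢ = ⟪u (i, true), u (i + 1, false)⟫`, `wᵢ = ⟪u (i, true), u (i, false)⟫` and
`vᵢ = ⟪u (i, true), n⟫`. -/

theorem gram_eq_of_sum_sq_eq_one {κ v w : Fin 3 → ℝ} (hκ : ∀ i, 0 < κ i) (hv : ∀ i, v i < 0)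
    (hsum : ∑ i, κ i ^ 2 = 1) (horth : ∀ i, κ i * w (i + 1) + v i * v (i + 1) = 0)
    (hnorm : ∀ i, w i ^ 2 + κ i ^ 2 + v i ^ 2 = 1) (i : Fin 3) :
    w i = -κ (i + 1) ∧ v i = -κ (i + 2) := by
  have horth' (i : Fin 3) : κ (i + 2) * w i + v (i + 2) * v i = 0 := by
    simpa only [show i + 2 + 1 = i by omega] using horth (i + 2)
  have hsq : (fun i => v i ^ 2) = fun i => κ (i + 2) ^ 2 := by
    refine eq_of_cyclic_mul_add_eq (fun i => pow_pos (hκ _) 2) (fun i => sq_nonneg _) fun i => ?_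
    rw [sum_fin_three_cyclic _ i] at hsum
    rw [show i + 2 + 2 = i + 1 by omega]
    linear_combination κ (i + 2) ^ 2 * (hnorm i - hsum) -
      (κ (i + 2) * w i - v (i + 2) * v i) * horth' i
  have hv_eq (i : Fin 3) : v i = -κ (i + 2) := by
    have := (sq_eq_sq₀ (neg_pos.2 (hv i)).le (hκ (i + 2)).le).1 ((neg_sq _).trans (congrFun hsq i))
    linarith
  refine ⟨mul_left_cancel₀ (hκ (i + 2)).ne' ?_, hv_eq i⟩
  have := horth' i
  rw [hv_eq i, hv_eq (i + 2), show i + 2 + 2 = i + 1 by omega] at this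
  linarith

theorem IsSphericalCube.exists_vertex {u : CubeFacet → ℝ⁴} {P : Set ℝ⁴} (h : IsSphericalCube u P)
    (ε : Fin 3 → Bool) : ∃ x : ℝ⁴, ‖x‖ = 1 ∧ (∀ i, inner ℝ (u (i, ε i)) x = 0) ∧
      ∀ i, inner ℝ (u (i, !ε i)) x < 0 := by
  obtain ⟨x, ⟨hx, hcone⟩, hface⟩ := (h.face_nonempty_iff {f | ε f.1 = f.2}).2 ⟨ε, fun _ hf => hf⟩
  refine ⟨x, mem_sphere_zero_iff_norm.1 hx, fun i => hface _ rfl, fun i => ?_⟩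
  refine lt_of_le_of_ne (hcone _) fun hopp => ?_
  obtain ⟨ε', hε'⟩ := (h.face_nonempty_iff {(i, ε i), (i, !ε i)}).1 ⟨x, ⟨hx, hcone⟩, by
    rintro f (rfl | rfl)
    · exact hface _ rfl
    · exact hopp⟩
  have heq : ε' i = ε i := hε' (i, ε i) (Or.inl rfl)
  have hne : ε' i = !ε i := hε' (i, !ε i) (Or.inr rfl)
  exact Bool.not_ne_self _ (hne.symm.trans heq)

theorem IsSphericalCube.exists_frame {u : CubeFacet → ℝ⁴} {P : Set ℝ⁴} (h : IsSphericalCube u P)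
    (hfalse : ∀ i, inner ℝ (u (i, false)) (u (i + 1, false)) = 0) :
    ∃ e : OrthonormalBasis (Fin 4) ℝ ℝ⁴, (∀ i, e i.castSucc = -u (i, false)) ∧
      ∀ i, inner ℝ (u (i, true)) (e 3) < 0 := by
  obtain ⟨n, hn, hn_zero, hn_neg⟩ := h.exists_vertex fun _ => false
  have hn_zero' (i : Fin 3) : inner ℝ n (u (i, false)) = 0 := by
    rw [real_inner_comm, hn_zero i]
  have horth : Orthonormal ℝ ![-u (0, false), -u (1, false), -u (2, false), n] := by
    have h01 := hfalse 0
    have h12 := hfalse 1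
    have h20 := hfalse 2
    have h10 := (real_inner_comm _ _).trans h01
    have h21 := (real_inner_comm _ _).trans h12
    have h02 := (real_inner_comm _ _).trans h20
    rw [orthonormal_iff_ite]
    intro i j
    fin_cases i <;> fin_cases j <;> simp_all [h.norm_normal]
  obtain ⟨e, he⟩ := exists_orthonormalBasis_coe_eq horth (by simp)
  refine ⟨e, fun i => ?_, ?_⟩
  · rw [he]
    fin_cases i <;> rfl
  · rw [he]
    exact hn_neg

variable {κ : Fin 3 → ℝ} {u : CubeFacet → ℝ⁴}

theorem true_normal_eq_of_frame {e : OrthonormalBasis (Fin 4) ℝ ℝ⁴}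
    (he : ∀ i, e i.castSucc = -u (i, false)) (hgram : ∀ (i : Fin 3) (s t : Bool),
      inner ℝ (u (i, s)) (u (i + 1, t)) = if s = true ∧ t = false then κ i else 0) (i : Fin 3) :
    u (i, true) = inner ℝ (u (i, true)) (u (i, false)) • u (i, false) + κ i • u (i + 1, false) +
      inner ℝ (u (i, true)) (e 3) • e 3 := by
  have hnext : inner ℝ (u (i, true)) (u (i + 1, false)) = κ i := by simp [hgram]
  have hprev : inner ℝ (u (i, true)) (u (i + 2, false)) = 0 := by
    rw [real_inner_comm]
    simpa only [show i + 2 + 1 = i by omega, Bool.false_eq_true, false_and, if_false]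
      using hgram (i + 2) false true
  conv_lhs => rw [← e.sum_repr' (u (i, true)), Fin.sum_univ_castSucc, sum_fin_three_cyclic _ i]
  simp only [he, real_inner_comm (u (i, true)), inner_neg_right, smul_neg, neg_smul, neg_neg,
    hnext, hprev, zero_smul, add_zero]
  rfl

theorem gram_relations_of_frame {e : OrthonormalBasis (Fin 4) ℝ ℝ⁴} (hnorm : ∀ f, ‖u f‖ = 1)
    (he : ∀ i, e i.castSucc = -u (i, false)) (hgram : ∀ (i : Fin 3) (s t : Bool),
      inner ℝ (u (i, s)) (u (i + 1, t)) = if s = true ∧ t = false then κ i else 0) (i : Fin 3) :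
    κ i * inner ℝ (u (i + 1, true)) (u (i + 1, false)) +
        inner ℝ (u (i, true)) (e 3) * inner ℝ (u (i + 1, true)) (e 3) = 0 ∧
      inner ℝ (u (i, true)) (u (i, false)) ^ 2 + κ i ^ 2 + inner ℝ (u (i, true)) (e 3) ^ 2 = 1 := by
  have expand (x : ℝ⁴) := congrArg (inner ℝ x) (true_normal_eq_of_frame he hgram i)
  simp only [inner_add_right, inner_smul_right] at expand
  have hself := expand (u (i, true))
  have hnext := expand (u (i + 1, true))
  simp only [real_inner_self_eq_norm_sq, hnorm, hgram, and_self, if_true] at hself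
  rw [real_inner_comm (u (i, true)) (u (i + 1, true)),
    real_inner_comm (u (i, false)) (u (i + 1, true)), hgram, hgram] at hnext
  simp only [Bool.false_eq_true, Bool.true_eq_false, and_false, if_false] at hnext
  constructor <;> linarith

theorem IsSphericalCube.gram_pos_of_frame {P : Set ℝ⁴} (hu : IsSphericalCube u P)
    {e : OrthonormalBasis (Fin 4) ℝ ℝ⁴} (he : ∀ i, e i.castSucc = -u (i, false))
    (he3 : ∀ i, inner ℝ (u (i, true)) (e 3) < 0) (hgram : ∀ (i : Fin 3) (s t : Bool),
      inner ℝ (u (i, s)) (u (i + 1, t)) = if s = true ∧ t = false then κ i else 0) (i : Fin 3) :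
    0 < κ (i + 2) := by
  obtain ⟨x, -, hx_zero, hx_neg⟩ := hu.exists_vertex fun j => decide (j = i)
  have expand (j : Fin 3) := congrArg (inner ℝ · x) (true_normal_eq_of_frame he hgram j)
  simp only [inner_add_left, real_inner_smul_left] at expand
  have h0 := hx_zero i
  have h0' := hx_neg i
  have h1 := hx_zero (i + 1)
  have h1' := hx_neg (i + 1)
  have h2 := hx_zero (i + 2)
  simp only [decide_true, Bool.not_true, show i + 1 ≠ i by omega, show i + 2 ≠ i by omega,
    decide_false, Bool.not_false] at h0 h0' h1 h1' h2
  have hx3 : 0 < inner ℝ (e 3) x := by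
    have := expand (i + 1)
    rw [show i + 1 + 1 = i + 2 by omega, h1, h2] at this
    exact pos_of_mul_neg_right (by linarith) (he3 (i + 1)).le
  have hw : inner ℝ (u (i, true)) (u (i, false)) < 0 := by
    have := expand i
    rw [h0, h1] at this
    refine neg_of_mul_pos_left ?_ h0'.le
    linarith [mul_neg_of_neg_of_pos (he3 i) hx3]
  have := (gram_relations_of_frame hu.norm_normal he hgram (i + 2)).1
  rw [show i + 2 + 1 = i by omega] at this
  refine pos_of_mul_neg_left ?_ hw.le
  linarith [mul_pos_of_neg_of_neg (he3 (i + 2)) (he3 i)]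

theorem IsSphericalCube.gram_pos_and_congruent {P : Set ℝ⁴} (hu : IsSphericalCube u P)
    (hgram : ∀ (i : Fin 3) (s t : Bool),
      inner ℝ (u (i, s)) (u (i + 1, t)) = if s = true ∧ t = false then κ i else 0)
    (hsum : ∑ i, κ i ^ 2 = 1) :
    (∀ i, 0 < κ i) ∧ SphericallyCongruent P (sphericalPolyhedron (lambertNormal κ)) := by
  obtain ⟨e, he, he3⟩ := hu.exists_frame fun i => by simp [hgram]
  have hκ (i : Fin 3) : 0 < κ i := by
    simpa only [show i + 1 + 2 = i by omega] using hu.gram_pos_of_frame he he3 hgram (i + 1)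
  have hrel := gram_relations_of_frame hu.norm_normal he hgram
  have hvw := gram_eq_of_sum_sq_eq_one hκ he3 hsum (fun i => (hrel i).1) fun i => (hrel i).2
  have hfalse (i : Fin 3) : e.repr (u (i, false)) = -EuclideanSpace.single i.castSucc 1 := by
    rw [← e.repr_self, he, map_neg, neg_neg]
  refine ⟨hκ, e.repr, ?_⟩
  rw [hu.eq_polyhedron, image_sphericalPolyhedron]
  congr 1
  ext1 ⟨i, s⟩
  cases s
  · exact hfalse i
  · rw [Function.comp_apply, true_normal_eq_of_frame he hgram i, (hvw i).1, (hvw i).2]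
    simp only [map_add, map_smul, hfalse, e.repr_self, lambertNormal]
    module

end Rigidity

section Uniqueness

variable {θ : Fin 3 → ℝ} {P : Set ℝ⁴}

theorem IsLambertCube.angle_mem_Icc (h : IsLambertCube (θ 0) (θ 1) (θ 2) P) (i : Fin 3) :
    θ i ∈ Set.Icc 0 π := by
  obtain ⟨u, -, hangle⟩ := h
  have := dihedralAngle_mem_Icc (u (i, true)) (u (i + 1, false))
  rw [hangle, if_pos ⟨rfl, rfl⟩] at this
  fin_cases i <;> exact this

theorem IsLambertCube.isObtusePythagorean_and_congruent (h : IsLambertCube (θ 0) (θ 1) (θ 2) P)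
    (hsum : ∑ i, Real.cos (θ i) ^ 2 = 1) :
    IsObtusePythagorean θ ∧ SphericallyCongruent P (standardLambertCube θ) := by
  obtain ⟨u, hu, hgram⟩ := (isLambertCube_iff_inner h.angle_mem_Icc).1 h
  obtain ⟨hκ, hcong⟩ := hu.gram_pos_and_congruent hgram (by simpa only [neg_sq] using hsum)
  refine ⟨⟨fun i => ⟨?_, ?_⟩, hsum⟩, hcong⟩
  · by_contra! hle
    have hcos := Real.cos_nonneg_of_mem_Icc ⟨by linarith [(h.angle_mem_Icc i).1, Real.pi_pos], hle⟩
    linarith [hκ i]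
  · refine lt_of_le_of_ne (h.angle_mem_Icc i).2 fun hπ => ?_
    rw [sum_fin_three_cyclic _ i, hπ, Real.cos_pi] at hsum
    nlinarith [hκ (i + 1), sq_nonneg (Real.cos (θ (i + 2)))]

end Uniqueness

section Symmetry

theorem of_triple_eq {α : Type*} {R : α → α → α → Prop}
    (rotate : ∀ {a b c}, R a b c → R b c a) (swap : ∀ {a b c}, R a b c → R b a c)
    {a b c a' b' c' : α} (h : R a b c) (habc : ({a, b, c} : Multiset α) = {a', b', c'}) :
    R a' b' c' := by
  have hperms : [a, b, c].permutations =
      [[a, b, c], [b, a, c], [c, b, a], [b, c, a], [c, a, b], [a, c, b]] := by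
    simp [List.permutations]
  have hmem : [a', b', c'] ∈ [a, b, c].permutations :=
    List.mem_permutations.2 (Multiset.coe_eq_coe.1 habc.symm)
  simp only [hperms, List.mem_cons, List.cons.injEq, and_true, List.not_mem_nil, or_false] at hmem
  rcases hmem with ⟨rfl, rfl, rfl⟩ | ⟨rfl, rfl, rfl⟩ | ⟨rfl, rfl, rfl⟩ | ⟨rfl, rfl, rfl⟩ |
    ⟨rfl, rfl, rfl⟩ | ⟨rfl, rfl, rfl⟩
  · exact h
  · exact swap h
  · exact rotate (rotate (swap h))
  · exact rotate h
  · exact rotate (rotate h)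
  · exact rotate (swap h)

variable {u : CubeFacet → ℝ⁴} {P : Set ℝ⁴} {a b c : ℝ}

theorem sphericalPolyhedron_comp_equiv (e : CubeFacet ≃ CubeFacet) :
    sphericalPolyhedron (u ∘ e) = sphericalPolyhedron u := by
  ext x
  exact and_congr_right fun _ => e.forall_congr_right (q := fun f => inner ℝ (u f) x ≤ 0)

theorem sphericalFace_comp_equiv (e : CubeFacet ≃ CubeFacet) (S : Set CubeFacet) :
    sphericalFace (u ∘ e) S = sphericalFace u (e '' S) := by
  ext x
  refine and_congr (by rw [sphericalPolyhedron_comp_equiv]) ?_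
  rw [Set.forall_mem_image]
  rfl

theorem IsSphericalCube.relabel (h : IsSphericalCube u P) (σ : Equiv.Perm (Fin 3))
    (τ : Equiv.Perm Bool) : IsSphericalCube (u ∘ σ.prodCongr τ) P where
  norm_normal f := h.norm_normal _
  eq_polyhedron := by rw [sphericalPolyhedron_comp_equiv, h.eq_polyhedron]
  face_nonempty_iff S := by
    rw [sphericalFace_comp_equiv, h.face_nonempty_iff]
    constructor
    · rintro ⟨ε, hε⟩
      exact ⟨fun i => τ.symm (ε (σ i)), fun f hf =>
        τ.symm_apply_eq.2 (hε _ (Set.mem_image_of_mem _ hf))⟩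
    · rintro ⟨ε, hε⟩
      refine ⟨fun i => τ (ε (σ.symm i)), Set.forall_mem_image.2 fun f hf => ?_⟩
      simp [hε f hf]

theorem dihedralAngle_comm (n m : ℝ⁴) : dihedralAngle n m = dihedralAngle m n := by
  rw [dihedralAngle, dihedralAngle, InnerProductGeometry.angle_comm]

theorem IsLambertCube.rotate (h : IsLambertCube a b c P) : IsLambertCube b c a P := by
  obtain ⟨u, hu, hangle⟩ := h
  refine ⟨_, hu.relabel (Equiv.addRight 1) (Equiv.refl _), fun i s t => ?_⟩
  refine (hangle (i + 1) s t).trans ?_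
  fin_cases i <;> rfl

-- Reversing the order of the coordinates turns the essential edges `(i, true)`, `(i + 1, false)`
-- into edges of the form `(i + 1, true)`, `(i, false)`; exchanging opposite facets restores them.
theorem IsLambertCube.swap (h : IsLambertCube a b c P) : IsLambertCube b a c P := by
  obtain ⟨u, hu, hangle⟩ := h
  refine ⟨_, hu.relabel Fin.revPerm Equiv.boolNot, fun i s t => ?_⟩
  have hedge := hangle (Fin.rev (i + 1)) (!t) (!s)
  rw [show Fin.rev (i + 1) + 1 = Fin.rev i by fin_cases i <;> rfl, dihedralAngle_comm] at hedge
  refine hedge.trans ?_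
  fin_cases i <;> cases s <;> cases t <;> rfl

theorem IsLambertCube.of_multiset_eq {a' b' c' : ℝ} (h : IsLambertCube a b c P)
    (habc : ({a, b, c} : Multiset ℝ) = {a', b', c'}) : IsLambertCube a' b' c' P :=
  of_triple_eq (R := fun a b c => IsLambertCube a b c P) .rotate .swap h habc

end Symmetry

section Sign

theorem measurable_real_sign : Measurable Real.sign :=
  measurable_const.ite measurableSet_Iio (measurable_const.ite measurableSet_Ioi measurable_const)

theorem abs_real_sign_le_one (x : ℝ) : |Real.sign x| ≤ 1 := by
  rcases Real.sign_apply_eq x with h | h | h <;> simp [h]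

theorem real_sign_mul_of_pos {r : ℝ} (hr : 0 < r) (x : ℝ) : Real.sign (r * x) = Real.sign x := by
  simp only [Real.sign, mul_neg_iff, mul_pos_iff_of_pos_left, hr, hr.not_gt, true_and, false_and,
    or_false]

theorem real_sign_eq_iff_mul_pos {x σ : ℝ} (hσ : σ = 1 ∨ σ = -1) :
    Real.sign x = σ ↔ 0 < σ * x := by
  rcases hσ with rfl | rfl <;> rw [Real.sign] <;> grind

end Sign

section CircleMean

/-- The mean over the unit circle of a function on the plane. -/
noncomputable def circleMean (f : ℝ × ℝ → ℝ) : ℝ :=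
  (∫ φ in Set.Ioo (-π) π, f (Real.cos φ, Real.sin φ)) / (2 * π)

/-- Measurable functions on the plane, bounded by `1` and homogeneous of degree `0`, such as
products of signs of linear forms. Their integrals against radial functions reduce to their circle
means. -/
structure IsBoundedHomogeneous (f : ℝ × ℝ → ℝ) : Prop where
  measurable : Measurable f
  abs_le_one : ∀ z, |f z| ≤ 1
  smul : ∀ r : ℝ, 0 < r → ∀ z, f (r • z) = f z

namespace IsBoundedHomogeneous

variable {f g : ℝ × ℝ → ℝ}

theorem one : IsBoundedHomogeneous fun _ => 1 :=
  ⟨measurable_const, fun _ => by simp, fun _ _ _ => rfl⟩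

theorem mul (hf : IsBoundedHomogeneous f) (hg : IsBoundedHomogeneous g) :
    IsBoundedHomogeneous (f * g) where
  measurable := hf.measurable.mul hg.measurable
  abs_le_one z := by
    rw [Pi.mul_apply, abs_mul]
    exact mul_le_one₀ (hf.abs_le_one z) (abs_nonneg _) (hg.abs_le_one z)
  smul r hr z := by simp only [Pi.mul_apply, hf.smul r hr, hg.smul r hr]

theorem sign_linear (a b : ℝ) : IsBoundedHomogeneous fun z => Real.sign (a * z.1 + b * z.2) where
  measurable := measurable_real_sign.comp (by fun_prop)
  abs_le_one z := abs_real_sign_le_one _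
  smul r hr z := by
    rw [← real_sign_mul_of_pos hr (a * z.1 + b * z.2), Prod.smul_fst, Prod.smul_snd]
    congr 1
    simp only [smul_eq_mul]
    ring

theorem sign_fst : IsBoundedHomogeneous fun z => Real.sign z.1 := by
  simpa only [one_mul, zero_mul, add_zero] using sign_linear 1 0

theorem intervalIntegrable (hf : IsBoundedHomogeneous f) (a b : ℝ) :
    IntervalIntegrable (fun φ => f (Real.cos φ, Real.sin φ)) volume a b := by
  refine (intervalIntegrable_const (c := (1 : ℝ))).mono_fun
    (hf.measurable.comp (by fun_prop)).aestronglyMeasurable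
    (Filter.Eventually.of_forall fun φ => ?_)
  rw [norm_one]
  exact hf.abs_le_one _

end IsBoundedHomogeneous

variable {f h : ℝ × ℝ → ℝ}

theorem integral_homogeneous_mul_radial_eq_mul_integral
    (hf : ∀ r : ℝ, 0 < r → ∀ z, f (r • z) = f z) (g : ℝ → ℝ) :
    ∫ z : ℝ × ℝ, f z * g (z.1 ^ 2 + z.2 ^ 2) =
      (∫ r in Set.Ioi (0 : ℝ), r * g (r ^ 2)) *
        ∫ φ in Set.Ioo (-π) π, f (Real.cos φ, Real.sin φ) := by
  rw [← integral_comp_polarCoord_symm, ← setIntegral_prod_mul]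
  refine setIntegral_congr_fun polarCoord.open_target.measurableSet fun p hp => ?_
  have hradius : (p.1 * Real.cos p.2) ^ 2 + (p.1 * Real.sin p.2) ^ 2 = p.1 ^ 2 := by
    linear_combination p.1 ^ 2 * Real.sin_sq_add_cos_sq p.2
  have hangle := hf p.1 hp.1 (Real.cos p.2, Real.sin p.2)
  simp only [Prod.smul_mk, smul_eq_mul] at hangle
  simp only [polarCoord_symm_apply, smul_eq_mul, hradius, hangle]
  ring

theorem circleMean_one : circleMean (fun _ => 1) = 1 := by
  simp [circleMean, ← two_mul, Real.pi_pos.le, Real.pi_ne_zero]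

theorem integral_homogeneous_mul_radial (hf : ∀ r : ℝ, 0 < r → ∀ z, f (r • z) = f z)
    (g : ℝ → ℝ) :
    ∫ z : ℝ × ℝ, f z * g (z.1 ^ 2 + z.2 ^ 2) =
      circleMean f * ∫ z : ℝ × ℝ, g (z.1 ^ 2 + z.2 ^ 2) := by
  have hone := integral_homogeneous_mul_radial_eq_mul_integral (f := fun _ => 1)
    (fun _ _ _ => rfl) g
  have hmean := circleMean_one
  rw [circleMean, div_eq_one_iff_eq (by positivity)] at hmean
  rw [hmean] at hone
  simp only [one_mul] at hone
  rw [integral_homogeneous_mul_radial_eq_mul_integral hf, hone, circleMean]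
  field_simp

theorem integral_homogeneous_mul_homogeneous_mul_radial (hf : IsBoundedHomogeneous f)
    (hh : IsBoundedHomogeneous h) (g : ℝ → ℝ) (hg : Integrable fun p : (ℝ × ℝ) × (ℝ × ℝ) =>
      g (p.1.1 ^ 2 + p.1.2 ^ 2 + (p.2.1 ^ 2 + p.2.2 ^ 2))) :
    ∫ p : (ℝ × ℝ) × (ℝ × ℝ), f p.1 * h p.2 * g (p.1.1 ^ 2 + p.1.2 ^ 2 + (p.2.1 ^ 2 + p.2.2 ^ 2)) =
      circleMean f * circleMean h *
        ∫ p : (ℝ × ℝ) × (ℝ × ℝ), g (p.1.1 ^ 2 + p.1.2 ^ 2 + (p.2.1 ^ 2 + p.2.2 ^ 2)) := by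
  have hfm := hf.measurable
  have hhm := hh.measurable
  have hint : Integrable fun p : (ℝ × ℝ) × (ℝ × ℝ) =>
      f p.1 * h p.2 * g (p.1.1 ^ 2 + p.1.2 ^ 2 + (p.2.1 ^ 2 + p.2.2 ^ 2)) := by
    refine hg.bdd_mul (c := 1) (by fun_prop) (Filter.Eventually.of_forall fun p => ?_)
    rw [Real.norm_eq_abs, abs_mul]
    exact mul_le_one₀ (hf.abs_le_one _) (abs_nonneg _) (hh.abs_le_one _)
  rw [Measure.volume_eq_prod] at hint hg ⊢
  rw [integral_prod _ hint, integral_prod _ hg]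
  have hinner (z : ℝ × ℝ) :
      ∫ w : ℝ × ℝ, f z * h w * g (z.1 ^ 2 + z.2 ^ 2 + (w.1 ^ 2 + w.2 ^ 2)) =
        circleMean h * (f z * ∫ w : ℝ × ℝ, g (z.1 ^ 2 + z.2 ^ 2 + (w.1 ^ 2 + w.2 ^ 2))) := by
    simp_rw [mul_assoc]
    rw [integral_const_mul,
      integral_homogeneous_mul_radial hh.smul (fun s => g (z.1 ^ 2 + z.2 ^ 2 + s))]
    ring
  simp_rw [hinner]
  rw [integral_const_mul, integral_homogeneous_mul_radial hf.smul
    (fun s => ∫ w : ℝ × ℝ, g (s + (w.1 ^ 2 + w.2 ^ 2)))]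
  ring

theorem circleMean_eq_intervalIntegral_div_pi (hf : IsBoundedHomogeneous f)
    (heven : ∀ z, f (-z) = f z) (t : ℝ) :
    circleMean f = (∫ φ in t..(t + π), f (Real.cos φ, Real.sin φ)) / π := by
  have hperiodic : Function.Periodic (fun φ => f (Real.cos φ, Real.sin φ)) π := fun φ => by
    simp only [Real.cos_add_pi, Real.sin_add_pi]
    exact heven (Real.cos φ, Real.sin φ)
  have htwo := hperiodic.intervalIntegral_add_zsmul_eq 2 (-π) hf.intervalIntegrable
  rw [show -π + (2 : ℤ) • π = π by rw [two_zsmul]; ring,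
    hperiodic.intervalIntegral_add_eq (-π) t, two_zsmul,
    intervalIntegral.integral_of_le (by linarith [Real.pi_pos]), integral_Ioc_eq_integral_Ioo]
    at htwo
  rw [circleMean, htwo]
  field_simp
  ring

theorem intervalIntegral_eq_of_forall_mem_Ioo {F : ℝ → ℝ} {a b c : ℝ} (hab : a ≤ b)
    (h : ∀ x ∈ Set.Ioo a b, F x = c) : ∫ x in a..b, F x = (b - a) * c := by
  rw [intervalIntegral.integral_of_le hab, integral_Ioc_eq_integral_Ioo,
    setIntegral_congr_fun measurableSet_Ioo h]
  simp [hab]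

/-- The product of the signs of two linear forms on the plane that make the angle `θ`. -/
noncomputable def signPair (θ : ℝ) : ℝ × ℝ → ℝ := fun z =>
  Real.sign z.1 * Real.sign (Real.cos θ * z.1 + Real.sin θ * z.2)

theorem isBoundedHomogeneous_signPair (θ : ℝ) : IsBoundedHomogeneous (signPair θ) :=
  .mul .sign_fst (.sign_linear _ _)

theorem signPair_neg (θ : ℝ) (z : ℝ × ℝ) : signPair θ (-z) = signPair θ z := by
  rw [signPair, Prod.fst_neg, Prod.snd_neg, mul_neg, mul_neg, ← neg_add, Real.sign_neg,
    Real.sign_neg, neg_mul_neg, signPair]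

theorem circleMean_signPair {θ : ℝ} (hθ : θ ∈ Set.Icc 0 π) :
    circleMean (signPair θ) = 1 - 2 * (θ / π) := by
  have hint := (isBoundedHomogeneous_signPair θ).intervalIntegrable
  obtain ⟨hθ0, hθπ⟩ := hθ
  rw [circleMean_eq_intervalIntegral_div_pi (isBoundedHomogeneous_signPair θ) (signPair_neg θ)
    (-(π / 2)),
    ← intervalIntegral.integral_add_adjacent_intervals (hint _ (θ - π / 2)) (hint _ _)]
  simp only [signPair, ← Real.cos_sub]
  rw [intervalIntegral_eq_of_forall_mem_Ioo (c := -1) (by linarith) fun φ hφ => ?_,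
    intervalIntegral_eq_of_forall_mem_Ioo (c := 1) (by linarith) fun φ hφ => ?_]
  · field_simp
    ring
  · rw [Real.sign_of_pos (Real.cos_pos_of_mem_Ioo ⟨by linarith [hφ.1], by linarith [hφ.2]⟩),
      Real.sign_of_pos (Real.cos_pos_of_mem_Ioo ⟨by linarith [hφ.2], by linarith [hφ.1]⟩),
      one_mul]
  · rw [Real.sign_of_pos (Real.cos_pos_of_mem_Ioo ⟨by linarith [hφ.1], by linarith [hφ.2]⟩),
      Real.sign_of_neg (Real.cos_neg_of_pi_div_two_lt_of_lt (by linarith [hφ.2])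
        (by linarith [hφ.1])), one_mul]

end CircleMean

section BallIntegral

open Metric

theorem measurePreserving_coordinate_pairs :
    MeasurePreserving fun x : ℝ⁴ => ((x 0, x 1), (x 2, x 3)) := by
  have h := EuclideanSpace.volume_preserving_symm_measurableEquiv_toLp (Fin 4)
  have h₀ := volume_preserving_piFinSuccAbove (fun _ : Fin 4 => ℝ) 0
  have h₁ := volume_preserving_piFinSuccAbove (fun _ : Fin 3 => ℝ) 0
  have h₂ := volume_preserving_piFinTwo (fun _ : Fin 2 => ℝ)
  have hid := MeasurePreserving.id (volume : Measure ℝ)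
  have hassoc := (volume_preserving_prodAssoc (α₁ := ℝ) (β₁ := ℝ) (γ₁ := ℝ × ℝ)).symm
  exact hassoc.comp <| (hid.prod (hid.prod h₂)).comp <| (hid.prod h₁).comp <| h₀.comp h

theorem measurePreserving_inner_pairs (e : OrthonormalBasis (Fin 4) ℝ ℝ⁴) :
    MeasurePreserving fun x : ℝ⁴ =>
      ((inner ℝ (e 0) x, inner ℝ (e 1) x), (inner ℝ (e 2) x, inner ℝ (e 3) x)) := by
  simpa only [Function.comp_def, OrthonormalBasis.repr_apply_apply] using
    measurePreserving_coordinate_pairs.comp e.measurePreserving_repr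

theorem volume_real_ball_four : (volume : Measure ℝ⁴).real (ball 0 1) = π ^ 2 / 2 := by
  rw [measureReal_def, InnerProductSpace.volume_ball_of_dim_even (k := 2) (by simp)]
  have hnonneg : 0 ≤ π ^ 2 / 2 := by positivity
  simp [hnonneg]

theorem indicator_inner_pairs (e : OrthonormalBasis (Fin 4) ℝ ℝ⁴) (x : ℝ⁴) :
    (Set.Iio (1 : ℝ)).indicator (1 : ℝ → ℝ) (inner ℝ (e 0) x ^ 2 + inner ℝ (e 1) x ^ 2 +
      (inner ℝ (e 2) x ^ 2 + inner ℝ (e 3) x ^ 2)) = (ball (0 : ℝ⁴) 1).indicator 1 x := by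
  rw [← add_assoc, ← Fin.sum_univ_four fun i => inner ℝ (e i) x ^ 2, e.sum_sq_inner_right]
  simp only [Set.indicator, Set.mem_Iio, mem_ball_zero_iff, sq_lt_one_iff₀ (norm_nonneg x),
    Pi.one_apply]

theorem measurable_indicator_radius_sq :
    Measurable fun p : (ℝ × ℝ) × (ℝ × ℝ) => (Set.Iio (1 : ℝ)).indicator (1 : ℝ → ℝ)
      (p.1.1 ^ 2 + p.1.2 ^ 2 + (p.2.1 ^ 2 + p.2.2 ^ 2)) :=
  (measurable_one.indicator measurableSet_Iio).comp (by fun_prop)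

theorem setIntegral_ball_inner_pairs (e : OrthonormalBasis (Fin 4) ℝ ℝ⁴)
    {F : (ℝ × ℝ) × (ℝ × ℝ) → ℝ} (hF : Measurable F) :
    ∫ x in ball (0 : ℝ⁴) 1,
        F ((inner ℝ (e 0) x, inner ℝ (e 1) x), (inner ℝ (e 2) x, inner ℝ (e 3) x)) =
      ∫ p, F p * (Set.Iio 1).indicator 1 (p.1.1 ^ 2 + p.1.2 ^ 2 + (p.2.1 ^ 2 + p.2.2 ^ 2)) := by
  have hmp := measurePreserving_inner_pairs e
  have hpush := integral_map (μ := volume) hmp.measurable.aemeasurable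
    (hF.mul measurable_indicator_radius_sq).aestronglyMeasurable
  rw [hmp.map_eq] at hpush
  refine Eq.trans ?_ hpush.symm
  simp only [Pi.mul_apply, indicator_inner_pairs, ← integral_indicator measurableSet_ball]
  congr 1 with x
  by_cases hx : x ∈ ball (0 : ℝ⁴) 1 <;> simp [hx]

theorem integrable_indicator_radius_sq :
    Integrable fun p : (ℝ × ℝ) × (ℝ × ℝ) => (Set.Iio (1 : ℝ)).indicator (1 : ℝ → ℝ)
      (p.1.1 ^ 2 + p.1.2 ^ 2 + (p.2.1 ^ 2 + p.2.2 ^ 2)) := by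
  let e := EuclideanSpace.basisFun (Fin 4) ℝ
  rw [← (measurePreserving_inner_pairs e).integrable_comp
    measurable_indicator_radius_sq.aestronglyMeasurable]
  have hball : IntegrableOn (1 : ℝ⁴ → ℝ) (ball 0 1) := integrableOn_const measure_ball_lt_top.ne
  exact (hball.integrable_indicator measurableSet_ball).congr
    (.of_forall fun x => (indicator_inner_pairs e x).symm)

variable {f h : ℝ × ℝ → ℝ}

theorem integral_ball_mul_eq_circleMean_mul_circleMean (e : OrthonormalBasis (Fin 4) ℝ ℝ⁴)
    (hf : IsBoundedHomogeneous f) (hh : IsBoundedHomogeneous h) :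
    ∫ x in ball (0 : ℝ⁴) 1,
        f (inner ℝ (e 0) x, inner ℝ (e 1) x) * h (inner ℝ (e 2) x, inner ℝ (e 3) x) =
      circleMean f * circleMean h * (π ^ 2 / 2) := by
  have hvolume := setIntegral_ball_inner_pairs e (F := fun _ => 1) measurable_const
  simp only [integral_const, smul_eq_mul, mul_one, one_mul, measureReal_restrict_apply_univ,
    volume_real_ball_four] at hvolume
  rw [hvolume, ← integral_homogeneous_mul_homogeneous_mul_radial hf hh _
    integrable_indicator_radius_sq]
  exact setIntegral_ball_inner_pairs e (F := fun p => f p.1 * h p.2)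
    ((hf.measurable.comp measurable_fst).mul (hh.measurable.comp measurable_snd))

end BallIntegral

section SignCorrelation

open Metric

theorem exists_eq_cos_smul_add_sin_smul {E : Type*} [NormedAddCommGroup E] [InnerProductSpace ℝ E]
    {a b : E} {θ : ℝ} (ha : ‖a‖ = 1) (hb : ‖b‖ = 1) (hθ : θ ∈ Set.Ioo 0 π)
    (hab : inner ℝ a b = Real.cos θ) :
    ∃ p : E, ‖p‖ = 1 ∧ inner ℝ a p = 0 ∧ b = Real.cos θ • a + Real.sin θ • p := by
  have hsin : 0 < Real.sin θ := Real.sin_pos_of_mem_Ioo hθ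
  have hnorm : ‖b - Real.cos θ • a‖ = Real.sin θ := by
    rw [← sq_eq_sq₀ (norm_nonneg _) hsin.le, norm_sub_sq_real, inner_smul_right,
      real_inner_comm, hab, norm_smul, ha, hb, mul_one, Real.norm_eq_abs, sq_abs, Real.sin_sq]
    ring
  refine ⟨(Real.sin θ)⁻¹ • (b - Real.cos θ • a), ?_, ?_, ?_⟩
  · rw [norm_smul, hnorm, norm_inv, Real.norm_eq_abs, abs_of_pos hsin, inv_mul_cancel₀ hsin.ne']
  · rw [inner_smul_right, inner_sub_right, hab, inner_smul_right, real_inner_self_eq_norm_sq, ha]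
    ring
  · rw [smul_inv_smul₀ hsin.ne', add_sub_cancel]

/-- The sign telling on which side of the hyperplane orthogonal to `v` the point `x` lies. -/
noncomputable def sideSign (v x : ℝ⁴) : ℝ :=
  Real.sign (inner ℝ v x)

@[fun_prop]
theorem measurable_sideSign (v : ℝ⁴) : Measurable (sideSign v) :=
  measurable_real_sign.comp (by fun_prop)

variable {a b c d : ℝ⁴} {θ φ : ℝ}

theorem integral_ball_sideSign_mul (ha : ‖a‖ = 1) (hb : ‖b‖ = 1) (hθ : θ ∈ Set.Ioo 0 π)
    (hab : inner ℝ a b = Real.cos θ) :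
    ∫ x in ball (0 : ℝ⁴) 1, sideSign a x * sideSign b x = (1 - 2 * (θ / π)) * (π ^ 2 / 2) := by
  obtain ⟨p, hp, hap, rfl⟩ := exists_eq_cos_smul_add_sin_smul ha hb hθ hab
  have horth : Orthonormal ℝ ((({0, 1} : Set (Fin 4)).domRestrict ![a, p, 0, 0])) := by
    rw [orthonormal_iff_ite]
    rintro ⟨i, rfl | rfl⟩ ⟨j, rfl | rfl⟩ <;> simp [ha, hp, hap, real_inner_comm, Subtype.ext_iff]
  obtain ⟨e, he⟩ := horth.exists_orthonormalBasis_extension_of_card_eq (by simp)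
  have he₀ : e 0 = a := he 0 (by simp)
  have he₁ : e 1 = p := he 1 (by simp)
  have hkey := integral_ball_mul_eq_circleMean_mul_circleMean e
    (isBoundedHomogeneous_signPair θ) .one
  rw [circleMean_signPair ⟨hθ.1.le, hθ.2.le⟩, circleMean_one, mul_one] at hkey
  simpa only [he₀, he₁, signPair, mul_one, sideSign, inner_add_left, real_inner_smul_left]
    using hkey

theorem integral_ball_sideSign_mul_eq_zero (ha : ‖a‖ = 1) (hb : ‖b‖ = 1)
    (hab : inner ℝ a b = 0) : ∫ x in ball (0 : ℝ⁴) 1, sideSign a x * sideSign b x = 0 := by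
  have hpi := Real.pi_pos
  rw [integral_ball_sideSign_mul ha hb (θ := π / 2) ⟨by positivity, by linarith⟩
    (hab.trans Real.cos_pi_div_two.symm)]
  field_simp
  ring

theorem integral_ball_sideSign_mul_mul_mul (ha : ‖a‖ = 1) (hb : ‖b‖ = 1) (hc : ‖c‖ = 1)
    (hd : ‖d‖ = 1) (hac : inner ℝ a c = 0) (had : inner ℝ a d = 0) (hbc : inner ℝ b c = 0)
    (hbd : inner ℝ b d = 0) (hθ : θ ∈ Set.Ioo 0 π) (hφ : φ ∈ Set.Ioo 0 π)
    (hab : inner ℝ a b = Real.cos θ) (hcd : inner ℝ c d = Real.cos φ) :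
    ∫ x in ball (0 : ℝ⁴) 1, sideSign a x * sideSign b x * (sideSign c x * sideSign d x) =
      (1 - 2 * (θ / π)) * (1 - 2 * (φ / π)) * (π ^ 2 / 2) := by
  obtain ⟨p, hp, hap, rfl⟩ := exists_eq_cos_smul_add_sin_smul ha hb hθ hab
  obtain ⟨q, hq, hcq, rfl⟩ := exists_eq_cos_smul_add_sin_smul hc hd hφ hcd
  have hsinθ := (Real.sin_pos_of_mem_Ioo hθ).ne'
  have hsinφ := (Real.sin_pos_of_mem_Ioo hφ).ne'
  simp only [inner_add_left, inner_add_right, real_inner_smul_left, real_inner_smul_right, hac,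
    mul_zero, zero_add, mul_eq_zero, hsinθ, hsinφ, false_or] at had hbc hbd
  simp only [hbc, had, mul_zero, zero_add, mul_eq_zero, hsinθ, hsinφ, false_or] at hbd
  have hcp : inner ℝ c p = 0 := (real_inner_comm p c).trans hbc
  have horth : Orthonormal ℝ ![a, p, c, q] := by
    rw [orthonormal_iff_ite]
    intro i j
    fin_cases i <;> fin_cases j <;>
      simp [ha, hp, hc, hq, hap, hcq, hac, had, hbc, hcp, hbd, real_inner_comm]
  obtain ⟨e, he⟩ := exists_orthonormalBasis_coe_eq horth (by simp)
  have hkey := integral_ball_mul_eq_circleMean_mul_circleMean e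
    (isBoundedHomogeneous_signPair θ) (isBoundedHomogeneous_signPair φ)
  rw [circleMean_signPair ⟨hθ.1.le, hθ.2.le⟩, circleMean_signPair ⟨hφ.1.le, hφ.2.le⟩, he] at hkey
  simpa only [signPair, sideSign, inner_add_left, real_inner_smul_left, Matrix.cons_val]
    using hkey

end SignCorrelation

section ConeVolume

open Metric

/-- The indicator function of the negative octant, expressed through six signs that are split into
two triples. -/
noncomputable def octant (s t : Fin 3 → ℝ) : ℝ :=
  ∏ i, (1 - s i) / 2 * ((1 - t i) / 2)

/-- The sum of the sign products that contribute to the volume of a Lambert cube through its `i`-th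
essential angle, modulo the cyclic numbering. -/
noncomputable def signCorrelation (s t : Fin 3 → ℝ) (i : Fin 3) : ℝ :=
  s i * s (i + 1) + t i * t (i + 1) + s i * t (i + 1) - t i * s (i + 1) +
    s i * t (i + 1) * (t i * s (i + 1))

theorem octant_orbit_sum {s t : Fin 3 → ℝ} (hs : ∀ i, s i = 1 ∨ s i = -1)
    (ht : ∀ i, t i = 1 ∨ t i = -1)
    (hexcluded : ∀ i, t i = -t (i + 2) → s i = t (i + 2) → s (i + 2) = t (i + 2) →
      s (i + 1) = t (i + 2)) :
    octant s t + octant t (-s) + octant (-s) (-t) + octant (-t) s =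
      -(1 / 8) + 1 / 8 * ∑ i, signCorrelation s t i := by
  have h₀ := hexcluded 0
  have h₁ := hexcluded 1
  have h₂ := hexcluded 2
  simp only [octant, signCorrelation, Fin.prod_univ_three, Fin.sum_univ_three, Fin.reduceAdd,
    Pi.neg_apply, zero_add] at h₀ h₁ h₂ ⊢
  revert h₀ h₁ h₂
  rcases hs 0 with hs₀ | hs₀ <;> rcases hs 1 with hs₁ | hs₁ <;> rcases hs 2 with hs₂ | hs₂ <;>
    rcases ht 0 with ht₀ | ht₀ <;> rcases ht 1 with ht₁ | ht₁ <;> rcases ht 2 with ht₂ | ht₂ <;>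
    norm_num [hs₀, hs₁, hs₂, ht₀, ht₁, ht₂]

variable {κ : Fin 3 → ℝ}

theorem lambertNormal_relation (κ : Fin 3 → ℝ) (i : Fin 3) (x : ℝ⁴) :
    κ i * inner ℝ (lambertNormal κ (i, true)) x -
        κ (i + 2) * inner ℝ (lambertNormal κ (i + 1, true)) x +
        κ i * κ (i + 1) * inner ℝ (lambertNormal κ (i, false)) x +
        κ (i + 1) * κ (i + 2) * inner ℝ (lambertNormal κ (i + 2, false)) x =
      (κ i ^ 2 + κ (i + 2) ^ 2) * inner ℝ (lambertNormal κ (i + 1, false)) x := by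
  simp only [inner_lambertNormal_true, inner_lambertNormal_false]
  fin_cases i <;> simp <;> ring

theorem norm_quaternion_mul (hsum : ∑ i, κ i ^ 2 = 1) (x : ℝ⁴) :
    ‖!₂[κ 0 * x 3 - κ 2 * x 1 + κ 1 * x 2, κ 1 * x 3 - κ 0 * x 2 + κ 2 * x 0,
      κ 2 * x 3 - κ 1 * x 0 + κ 0 * x 1, -(κ 0 * x 0 + κ 1 * x 1 + κ 2 * x 2)]‖ = ‖x‖ := by
  rw [Fin.sum_univ_three] at hsum
  rw [← sq_eq_sq₀ (norm_nonneg _) (norm_nonneg _), EuclideanSpace.real_norm_sq_eq,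
    EuclideanSpace.real_norm_sq_eq, Fin.sum_univ_four, Fin.sum_univ_four]
  simp only [Matrix.cons_val]
  linear_combination (x 0 ^ 2 + x 1 ^ 2 + x 2 ^ 2 + x 3 ^ 2) * hsum

/-- Multiplication of quaternions by the imaginary unit `κ 0 i + κ 1 j + κ 2 k`, where `x 3` is the
real part. -/
noncomputable def quaternionRotation (κ : Fin 3 → ℝ) (hsum : ∑ i, κ i ^ 2 = 1) : ℝ⁴ ≃ₗᵢ[ℝ] ℝ⁴ :=
  LinearIsometry.toLinearIsometryEquiv
    { toFun x := !₂[κ 0 * x 3 - κ 2 * x 1 + κ 1 * x 2, κ 1 * x 3 - κ 0 * x 2 + κ 2 * x 0,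
        κ 2 * x 3 - κ 1 * x 0 + κ 0 * x 1, -(κ 0 * x 0 + κ 1 * x 1 + κ 2 * x 2)]
      map_add' x y := by ext i; fin_cases i <;> simp <;> ring
      map_smul' r x := by ext i; fin_cases i <;> simp <;> ring
      norm_map' := norm_quaternion_mul hsum } rfl

theorem quaternionRotation_apply (hsum : ∑ i, κ i ^ 2 = 1) (x : ℝ⁴) :
    quaternionRotation κ hsum x = !₂[κ 0 * x 3 - κ 2 * x 1 + κ 1 * x 2,
      κ 1 * x 3 - κ 0 * x 2 + κ 2 * x 0, κ 2 * x 3 - κ 1 * x 0 + κ 0 * x 1,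
      -(κ 0 * x 0 + κ 1 * x 1 + κ 2 * x 2)] := rfl

theorem inner_lambertNormal_false_quaternionRotation (hsum : ∑ i, κ i ^ 2 = 1) (i : Fin 3)
    (x : ℝ⁴) : inner ℝ (lambertNormal κ (i, false)) (quaternionRotation κ hsum x) =
      inner ℝ (lambertNormal κ (i + 1, true)) x := by
  rw [inner_lambertNormal_false, inner_lambertNormal_true, quaternionRotation_apply]
  fin_cases i <;> simp <;> ring

theorem quaternionRotation_quaternionRotation (hsum : ∑ i, κ i ^ 2 = 1) (x : ℝ⁴) :
    quaternionRotation κ hsum (quaternionRotation κ hsum x) = -x := by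
  have hsum' := hsum
  rw [Fin.sum_univ_three] at hsum'
  ext i
  rw [quaternionRotation_apply, quaternionRotation_apply]
  fin_cases i <;> simp only [PiLp.neg_apply, Fin.reduceFinMk, Matrix.cons_val]
  · linear_combination -x 0 * hsum'
  · linear_combination -x 1 * hsum'
  · linear_combination -x 2 * hsum'
  · linear_combination -x 3 * hsum'

/-- The side of `x` with respect to the facet `(i, false)`. -/
noncomputable def lowerSign (κ : Fin 3 → ℝ) (x : ℝ⁴) (i : Fin 3) : ℝ :=
  sideSign (lambertNormal κ (i, false)) x

/-- The side of `x` with respect to the facet `(i + 1, true)`, which `quaternionRotation` takes to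
the facet `(i, false)`. -/
noncomputable def upperSign (κ : Fin 3 → ℝ) (x : ℝ⁴) (i : Fin 3) : ℝ :=
  sideSign (lambertNormal κ (i + 1, true)) x

theorem lowerSign_quaternionRotation (hsum : ∑ i, κ i ^ 2 = 1) (x : ℝ⁴) :
    lowerSign κ (quaternionRotation κ hsum x) = upperSign κ x := by
  funext i
  rw [lowerSign, upperSign, sideSign, inner_lambertNormal_false_quaternionRotation, sideSign]

theorem upperSign_quaternionRotation (hsum : ∑ i, κ i ^ 2 = 1) (x : ℝ⁴) :
    upperSign κ (quaternionRotation κ hsum x) = -lowerSign κ x := by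
  funext i
  rw [upperSign, sideSign, ← inner_lambertNormal_false_quaternionRotation hsum,
    quaternionRotation_quaternionRotation, inner_neg_right, Real.sign_neg, Pi.neg_apply, lowerSign,
    sideSign]

theorem lowerSign_add_one_eq (hκ : ∀ i, 0 < κ i) {σ : ℝ} (hσ : σ = 1 ∨ σ = -1)
    (i : Fin 3) (x : ℝ⁴) (hsucc : upperSign κ x i = -σ) (htrue : upperSign κ x (i + 2) = σ)
    (hfalse : lowerSign κ x i = σ) (hpred : lowerSign κ x (i + 2) = σ) :
    lowerSign κ x (i + 1) = σ := by
  have hi : i + 2 + 1 = i := by omega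
  have hσ' : -σ = 1 ∨ -σ = -1 := by rcases hσ with rfl | rfl <;> norm_num
  rw [lowerSign, sideSign, real_sign_eq_iff_mul_pos hσ] at hfalse hpred ⊢
  rw [upperSign, sideSign, real_sign_eq_iff_mul_pos hσ, hi] at htrue
  rw [upperSign, sideSign, real_sign_eq_iff_mul_pos hσ'] at hsucc
  have hκ₀ := hκ i
  have hκ₁ := hκ (i + 1)
  have hκ₂ := hκ (i + 2)
  refine pos_of_mul_pos_right (a := κ i ^ 2 + κ (i + 2) ^ 2) ?_ (by positivity)
  rw [mul_left_comm, ← lambertNormal_relation]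
  linarith [mul_pos hκ₀ htrue, mul_pos hκ₂ hsucc, mul_pos (mul_pos hκ₀ hκ₁) hfalse,
    mul_pos (mul_pos hκ₁ hκ₂) hpred]

/-- The indicator function of the cone with outward normals `lambertNormal κ`, up to a null set. -/
noncomputable def lambertConeIndicator (κ : Fin 3 → ℝ) (x : ℝ⁴) : ℝ :=
  octant (lowerSign κ x) (upperSign κ x)

theorem ae_inner_ne_zero {v : ℝ⁴} (hv : v ≠ 0) : ∀ᵐ x : ℝ⁴, inner ℝ v x ≠ 0 := by
  have hker : LinearMap.ker (innerSL ℝ v).toLinearMap ≠ ⊤ := fun h => by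
    have hself : inner ℝ v v = 0 := LinearMap.mem_ker.1 (h ▸ Submodule.mem_top (x := v))
    exact hv (inner_self_eq_zero.1 hself)
  exact measure_eq_zero_iff_ae_notMem.1 (Measure.addHaar_submodule volume _ hker)

theorem ae_inner_lambertNormal_ne_zero (hsum : ∑ i, κ i ^ 2 = 1) :
    ∀ᵐ x : ℝ⁴, ∀ f, inner ℝ (lambertNormal κ f) x ≠ 0 :=
  ae_all_iff.2 fun f => ae_inner_ne_zero (norm_ne_zero_iff.1 (by simp [norm_lambertNormal hsum]))

theorem ae_sum_range_lambertConeIndicator (hκ : ∀ i, 0 < κ i) (hsum : ∑ i, κ i ^ 2 = 1) :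
    ∀ᵐ x : ℝ⁴, ∑ k ∈ Finset.range 4, lambertConeIndicator κ ((quaternionRotation κ hsum ^ k) x) =
      -(1 / 8) + 1 / 8 * ∑ i, signCorrelation (lowerSign κ x) (upperSign κ x) i := by
  filter_upwards [ae_inner_lambertNormal_ne_zero hsum] with x hx
  have hlower (i) : lowerSign κ x i = 1 ∨ lowerSign κ x i = -1 :=
    (Real.sign_apply_eq_of_ne_zero _ (hx (i, false))).symm
  have hupper (i) : upperSign κ x i = 1 ∨ upperSign κ x i = -1 :=
    (Real.sign_apply_eq_of_ne_zero _ (hx (i + 1, true))).symm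
  simp only [Finset.sum_range_succ, Finset.sum_range_zero, zero_add, pow_succ, pow_zero, one_mul,
    LinearIsometryEquiv.coe_one, LinearIsometryEquiv.coe_mul, Function.comp_apply, id_eq,
    lambertConeIndicator, lowerSign_quaternionRotation, upperSign_quaternionRotation, neg_neg]
  exact octant_orbit_sum hlower hupper fun i hsucc =>
    lowerSign_add_one_eq hκ (hupper _) i x hsucc rfl

theorem integral_ball_sum_range_pow (g : ℝ⁴ ≃ₗᵢ[ℝ] ℝ⁴) {F : ℝ⁴ → ℝ}
    (hF : IntegrableOn F (ball 0 1)) (n : ℕ) :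
    ∫ x in ball (0 : ℝ⁴) 1, ∑ k ∈ Finset.range n, F ((g ^ k) x) =
      n * ∫ x in ball (0 : ℝ⁴) 1, F x := by
  have hball (k : ℕ) : (g ^ k) ⁻¹' ball (0 : ℝ⁴) 1 = ball (0 : ℝ⁴) 1 := by simp
  have hemb (k : ℕ) := (g ^ k).toHomeomorph.measurableEmbedding
  have hint (k : ℕ) : IntegrableOn (fun x => F ((g ^ k) x)) (ball 0 1) :=
    hball k ▸ ((g ^ k).measurePreserving.integrableOn_comp_preimage (hemb k)).2 hF
  have hinv (k : ℕ) : ∫ x in ball (0 : ℝ⁴) 1, F ((g ^ k) x) = ∫ x in ball (0 : ℝ⁴) 1, F x := by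
    rw [← (g ^ k).measurePreserving.setIntegral_preimage_emb (hemb k) F, hball]
  rw [integral_finsetSum _ fun k _ => hint k, Finset.sum_congr rfl fun k _ => hinv k,
    Finset.sum_const, Finset.card_range, nsmul_eq_mul]

theorem integrableOn_ball_of_abs_le_one {F : ℝ⁴ → ℝ} (hF : Measurable F) (hbound : ∀ x, |F x| ≤ 1) :
    IntegrableOn F (ball 0 1) :=
  Measure.integrableOn_of_bounded measure_ball_lt_top.ne hF.aestronglyMeasurable
    (Filter.Eventually.of_forall hbound)

theorem abs_sideSign_mul_le_one (a b x : ℝ⁴) : |sideSign a x * sideSign b x| ≤ 1 := by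
  rw [abs_mul]
  exact mul_le_one₀ (abs_real_sign_le_one _) (abs_nonneg _) (abs_real_sign_le_one _)

theorem integrableOn_ball_sideSign_mul (a b : ℝ⁴) :
    IntegrableOn (fun x => sideSign a x * sideSign b x) (ball 0 1) :=
  integrableOn_ball_of_abs_le_one (by fun_prop) (abs_sideSign_mul_le_one a b)

theorem integrableOn_ball_sideSign_mul_mul_mul (a b c d : ℝ⁴) :
    IntegrableOn (fun x => sideSign a x * sideSign b x * (sideSign c x * sideSign d x))
      (ball 0 1) :=
  integrableOn_ball_of_abs_le_one (by fun_prop) fun x => by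
    rw [abs_mul]
    exact mul_le_one₀ (abs_sideSign_mul_le_one a b x) (abs_nonneg _)
      (abs_sideSign_mul_le_one c d x)

theorem integrableOn_ball_signCorrelation (κ : Fin 3 → ℝ) (i : Fin 3) :
    IntegrableOn (fun x => signCorrelation (lowerSign κ x) (upperSign κ x) i) (ball 0 1) :=
  ((((integrableOn_ball_sideSign_mul _ _).add (integrableOn_ball_sideSign_mul _ _)).add
    (integrableOn_ball_sideSign_mul _ _)).sub (integrableOn_ball_sideSign_mul _ _)).add
    (integrableOn_ball_sideSign_mul_mul_mul _ _ _ _)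

theorem inner_lambertNormal_true_lambertNormal_false (κ : Fin 3 → ℝ) (i : Fin 3) :
    inner ℝ (lambertNormal κ (i, true)) (lambertNormal κ (i, false)) = -κ (i + 1) := by
  rw [inner_lambertNormal_true]
  fin_cases i <;> simp [lambertNormal]

theorem integral_ball_signCorrelation (hsum : ∑ i, κ i ^ 2 = 1) {i : Fin 3} {A : ℝ}
    (hA : A ∈ Set.Ioo 0 π) (hκA : κ (i + 2) = Real.cos A) :
    ∫ x in ball (0 : ℝ⁴) 1, signCorrelation (lowerSign κ x) (upperSign κ x) i =
      (1 - 4 * (A / π) ^ 2) * (π ^ 2 / 2) := by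
  have hA' : π - A ∈ Set.Ioo 0 π := ⟨by linarith [hA.2], by linarith [hA.1]⟩
  have hnorm := norm_lambertNormal hsum
  have hsucc := inner_lambertNormal_lambertNormal_succ κ
  have hpred (s t : Bool) : inner ℝ (lambertNormal κ (i, s)) (lambertNormal κ (i + 2, t)) =
      if t = true ∧ s = false then κ (i + 2) else 0 := by
    rw [real_inner_comm, ← hsucc (i + 2) t s, show i + 2 + 1 = i by omega]
  have hnext (s t : Bool) : inner ℝ (lambertNormal κ (i + 2, t)) (lambertNormal κ (i + 1, s)) =
      if s = true ∧ t = false then κ (i + 1) else 0 := by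
    rw [real_inner_comm, ← hsucc (i + 1) s t, show i + 1 + 1 = i + 2 by omega]
  have hopp : inner ℝ (lambertNormal κ (i + 1, true)) (lambertNormal κ (i + 1, false)) =
      Real.cos (π - A) := by
    rw [inner_lambertNormal_true_lambertNormal_false, Real.cos_pi_sub, ← hκA,
      show i + 1 + 1 = i + 2 by omega]
  have hint := integrableOn_ball_sideSign_mul
  simp only [signCorrelation, lowerSign, upperSign, show i + 1 + 1 = i + 2 by omega]
  rw [integral_add ?_ (integrableOn_ball_sideSign_mul_mul_mul _ _ _ _),
    integral_sub ?_ (hint _ _), integral_add ?_ (hint _ _), integral_add (hint _ _) (hint _ _),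
    integral_ball_sideSign_mul_eq_zero (hnorm _) (hnorm _) (by simp [hsucc]),
    integral_ball_sideSign_mul_eq_zero (hnorm _) (hnorm _)
      (by rw [real_inner_comm]; simp [hnext]),
    integral_ball_sideSign_mul (hnorm _) (hnorm _) hA (by simp [hpred, hκA]),
    integral_ball_sideSign_mul (hnorm _) (hnorm _) hA' hopp,
    integral_ball_sideSign_mul_mul_mul (hnorm _) (hnorm _) (hnorm _) (hnorm _) (by simp [hsucc])
      (by simp [hsucc]) (by simp [hnext]) (by simp [hnext]) hA hA' (by simp [hpred, hκA]) hopp]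
  · have := Real.pi_ne_zero
    field_simp
    ring
  · exact (hint _ _).add (hint _ _)
  · exact ((hint _ _).add (hint _ _)).add (hint _ _)
  · exact (((hint _ _).add (hint _ _)).add (hint _ _)).sub (hint _ _)

theorem measurable_lambertConeIndicator (κ : Fin 3 → ℝ) : Measurable (lambertConeIndicator κ) := by
  unfold lambertConeIndicator octant lowerSign upperSign
  fun_prop

theorem abs_octant_le_one {s t : Fin 3 → ℝ} (hs : ∀ i, |s i| ≤ 1) (ht : ∀ i, |t i| ≤ 1) :
    |octant s t| ≤ 1 := by
  have hhalf {r : ℝ} (hr : |r| ≤ 1) : |(1 - r) / 2| ≤ 1 := by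
    rw [abs_le] at hr ⊢
    constructor <;> linarith
  rw [octant, Finset.abs_prod]
  refine Finset.prod_le_one (fun i _ => abs_nonneg _) fun i _ => ?_
  rw [abs_mul]
  exact mul_le_one₀ (hhalf (hs i)) (abs_nonneg _) (hhalf (ht i))

theorem integrableOn_ball_lambertConeIndicator (κ : Fin 3 → ℝ) :
    IntegrableOn (lambertConeIndicator κ) (ball 0 1) :=
  integrableOn_ball_of_abs_le_one (measurable_lambertConeIndicator κ) fun _ =>
    abs_octant_le_one (fun _ => abs_real_sign_le_one _) fun _ => abs_real_sign_le_one _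

theorem four_mul_integral_ball_lambertConeIndicator (hκ : ∀ i, 0 < κ i)
    (hsum : ∑ i, κ i ^ 2 = 1) :
    4 * ∫ x in ball (0 : ℝ⁴) 1, lambertConeIndicator κ x = -(1 / 8) * (π ^ 2 / 2) +
      1 / 8 * ∑ i, ∫ x in ball (0 : ℝ⁴) 1, signCorrelation (lowerSign κ x) (upperSign κ x) i := by
  have hcorr (i) := integrableOn_ball_signCorrelation κ i
  have hconst : IntegrableOn (fun _ : ℝ⁴ => -(1 / 8 : ℝ)) (ball 0 1) :=
    integrableOn_const measure_ball_lt_top.ne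
  calc
    _ = ∫ x in ball (0 : ℝ⁴) 1, ∑ k ∈ Finset.range 4,
        lambertConeIndicator κ ((quaternionRotation κ hsum ^ k) x) :=
      (integral_ball_sum_range_pow _ (integrableOn_ball_lambertConeIndicator κ) 4).symm
    _ = ∫ x in ball (0 : ℝ⁴) 1, -(1 / 8) +
        1 / 8 * ∑ i, signCorrelation (lowerSign κ x) (upperSign κ x) i :=
      integral_congr_ae (ae_restrict_of_ae (ae_sum_range_lambertConeIndicator hκ hsum))
    _ = _ := by
      rw [integral_add hconst ((integrable_finsetSum _ fun i _ => hcorr i).const_mul _),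
        integral_const_mul, integral_finsetSum _ fun i _ => hcorr i, setIntegral_const,
        volume_real_ball_four, smul_eq_mul, mul_comm]

theorem IsObtusePythagorean.integral_ball_lambertConeIndicator {θ : Fin 3 → ℝ}
    (hθ : IsObtusePythagorean θ) :
    ∫ x in ball (0 : ℝ⁴) 1, lambertConeIndicator (fun i => -Real.cos (θ i)) x =
      (π ^ 2 / 2 - ∑ i, (π - θ i) ^ 2) / 16 := by
  have hkey := four_mul_integral_ball_lambertConeIndicator hθ.neg_cos_pos hθ.sum_neg_cos_sq
  have hcorr (i) := integral_ball_signCorrelation hθ.sum_neg_cos_sq (i := i)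
    (A := π - θ (i + 2)) (by
      have hmem := hθ.mem_Ioo (i + 2)
      constructor <;> linarith [hmem.1, hmem.2, Real.pi_pos]) (Real.cos_pi_sub _).symm
  simp only [hcorr, Fin.sum_univ_three, Fin.reduceAdd] at hkey ⊢
  have := Real.pi_ne_zero
  field_simp at hkey ⊢
  linarith

end ConeVolume

section SphericalVolume

open Metric
open scoped Pointwise

theorem sphericalVolume_eq {P : Set ℝ⁴} (hP : MeasurableSet P) :
    sphericalVolume P = 4 * volume (Set.Ioo (0 : ℝ) 1 • (sphere 0 1 ∩ P)) := by
  rw [sphericalVolume, Measure.toSphere_apply' _ (measurable_subtype_coe hP),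
    Subtype.image_preimage_coe, finrank_euclideanSpace_fin, Nat.cast_ofNat]

theorem sphericalVolume_image (g : ℝ⁴ ≃ₗᵢ[ℝ] ℝ⁴) {P : Set ℝ⁴} (hP : MeasurableSet P) :
    sphericalVolume (g '' P) = sphericalVolume P := by
  have hemb : MeasurableEmbedding g := g.toHomeomorph.measurableEmbedding
  have hcone : Set.Ioo (0 : ℝ) 1 • (sphere 0 1 ∩ g '' P) =
      g '' (Set.Ioo (0 : ℝ) 1 • (sphere 0 1 ∩ P)) := calc
    _ = Set.Ioo (0 : ℝ) 1 • g '' (sphere 0 1 ∩ P) := by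
      rw [Set.image_inter g.injective, g.image_sphere, map_zero]
    _ = _ := (Set.image_image2_distrib_right fun r x => g.map_smul r x).symm
  rw [sphericalVolume_eq hP, sphericalVolume_eq (hemb.measurableSet_image.2 hP), hcone,
    ← g.measurePreserving.measure_preimage_emb hemb, Set.preimage_image_eq _ g.injective]

theorem measurableSet_forall_inner_nonpos (u : CubeFacet → ℝ⁴) :
    MeasurableSet {x : ℝ⁴ | ∀ f, inner ℝ (u f) x ≤ 0} := by
  simp only [Set.ofPred_forall]
  exact MeasurableSet.iInter fun f => measurableSet_le (by fun_prop) measurable_const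

theorem measurableSet_sphericalPolyhedron (u : CubeFacet → ℝ⁴) :
    MeasurableSet (sphericalPolyhedron u) :=
  isClosed_sphere.measurableSet.inter (measurableSet_forall_inner_nonpos u)

theorem Ioo_smul_sphericalPolyhedron (u : CubeFacet → ℝ⁴) :
    Set.Ioo (0 : ℝ) 1 • sphericalPolyhedron u =
      {x ∈ ball (0 : ℝ⁴) 1 | x ≠ 0 ∧ ∀ f, inner ℝ (u f) x ≤ 0} := by
  ext x
  constructor
  · rintro ⟨r, ⟨hr₀, hr₁⟩, p, ⟨hp, hle⟩, rfl⟩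
    rw [mem_sphere_zero_iff_norm] at hp
    have hp₀ : p ≠ 0 := norm_ne_zero_iff.1 (by simp [hp])
    refine ⟨?_, smul_ne_zero hr₀.ne' hp₀, fun f => ?_⟩
    · simp [norm_smul, hp, abs_of_pos hr₀, hr₁]
    · rw [inner_smul_right]
      exact mul_nonpos_of_nonneg_of_nonpos hr₀.le (hle f)
  · rintro ⟨hx₁, hx₀, hle⟩
    have hnorm := norm_pos_iff.2 hx₀
    refine ⟨‖x‖, ⟨hnorm, mem_ball_zero_iff.1 hx₁⟩, ‖x‖⁻¹ • x, ⟨?_, fun f => ?_⟩,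
      smul_inv_smul₀ hnorm.ne' x⟩
    · simp [norm_smul, hnorm.ne']
    · rw [inner_smul_right]
      exact mul_nonpos_of_nonneg_of_nonpos (inv_nonneg.2 hnorm.le) (hle f)

theorem Ioo_smul_sphericalPolyhedron_subset_ball (u : CubeFacet → ℝ⁴) :
    Set.Ioo (0 : ℝ) 1 • sphericalPolyhedron u ⊆ ball 0 1 := by
  rw [Ioo_smul_sphericalPolyhedron]
  exact Set.sep_subset _ _

theorem sphericalVolume_sphericalPolyhedron (u : CubeFacet → ℝ⁴) :
    sphericalVolume (sphericalPolyhedron u) =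
      ENNReal.ofReal (4 * volume.real (Set.Ioo (0 : ℝ) 1 • sphericalPolyhedron u)) := by
  have hfinite := measure_ne_top_of_subset (Ioo_smul_sphericalPolyhedron_subset_ball u)
    (measure_ball_lt_top (μ := volume)).ne
  rw [sphericalVolume_eq (measurableSet_sphericalPolyhedron u),
    Set.inter_eq_right.2 fun _ hx => hx.1, ENNReal.ofReal_mul zero_le_four,
    ENNReal.ofReal_ofNat, ofReal_measureReal hfinite]

theorem measurableSet_Ioo_smul_sphericalPolyhedron (u : CubeFacet → ℝ⁴) :
    MeasurableSet (Set.Ioo (0 : ℝ) 1 • sphericalPolyhedron u) := by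
  rw [Ioo_smul_sphericalPolyhedron]
  exact measurableSet_ball.inter
    ((measurableSet_singleton 0).compl.inter (measurableSet_forall_inner_nonpos u))

theorem lambertConeIndicator_of_forall_neg {κ : Fin 3 → ℝ} {x : ℝ⁴}
    (hx : ∀ f, inner ℝ (lambertNormal κ f) x < 0) : lambertConeIndicator κ x = 1 := by
  simp [lambertConeIndicator, octant, lowerSign, upperSign, sideSign, Real.sign_of_neg (hx _)]

theorem lambertConeIndicator_of_pos {κ : Fin 3 → ℝ} {x : ℝ⁴} {f : CubeFacet}
    (hf : 0 < inner ℝ (lambertNormal κ f) x) : lambertConeIndicator κ x = 0 := by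
  have hf : sideSign (lambertNormal κ f) x = 1 := Real.sign_of_pos hf
  rcases f with ⟨i, _ | _⟩
  · rw [lambertConeIndicator, octant, Finset.prod_eq_zero (Finset.mem_univ i)]
    simp [lowerSign, hf]
  · rw [lambertConeIndicator, octant, Finset.prod_eq_zero (Finset.mem_univ (i + 2))]
    simp [upperSign, show i + 2 + 1 = i by omega, hf]

theorem lambertConeIndicator_eq_indicator {κ : Fin 3 → ℝ} {x : ℝ⁴} (hx₁ : x ∈ ball (0 : ℝ⁴) 1)
    (hx : ∀ f, inner ℝ (lambertNormal κ f) x ≠ 0) : lambertConeIndicator κ x =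
      (Set.Ioo (0 : ℝ) 1 • sphericalPolyhedron (lambertNormal κ)).indicator 1 x := by
  rw [Ioo_smul_sphericalPolyhedron]
  by_cases hle : ∀ f, inner ℝ (lambertNormal κ f) x ≤ 0
  · have hx₀ : x ≠ 0 := fun h => hx (0, false) (by rw [h, inner_zero_right])
    rw [lambertConeIndicator_of_forall_neg fun f => (hle f).lt_of_ne (hx f)]
    exact (if_pos ⟨hx₁, hx₀, hle⟩).symm
  · obtain ⟨f, hf⟩ := not_forall.1 hle
    rw [Set.indicator_of_notMem fun h => hle h.2.2, lambertConeIndicator_of_pos (not_le.1 hf)]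

theorem integral_ball_lambertConeIndicator_eq {κ : Fin 3 → ℝ} (hsum : ∑ i, κ i ^ 2 = 1) :
    ∫ x in ball (0 : ℝ⁴) 1, lambertConeIndicator κ x =
      volume.real (Set.Ioo (0 : ℝ) 1 • sphericalPolyhedron (lambertNormal κ)) := by
  have hmeas := measurableSet_Ioo_smul_sphericalPolyhedron (lambertNormal κ)
  have hsubset := Ioo_smul_sphericalPolyhedron_subset_ball (lambertNormal κ)
  rw [← Set.inter_eq_left.2 hsubset, ← measureReal_restrict_apply hmeas,
    ← integral_indicator_one hmeas]
  refine setIntegral_congr_ae measurableSet_ball ?_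
  filter_upwards [ae_inner_lambertNormal_ne_zero hsum] with x hx hx₁
  exact lambertConeIndicator_eq_indicator hx₁ hx

theorem IsObtusePythagorean.sphericalVolume_standardLambertCube {θ : Fin 3 → ℝ}
    (hθ : IsObtusePythagorean θ) : sphericalVolume (standardLambertCube θ) =
      ENNReal.ofReal ((π ^ 2 / 2 - ∑ i, (π - θ i) ^ 2) / 4) := by
  have hreal := hθ.integral_ball_lambertConeIndicator
  rw [integral_ball_lambertConeIndicator_eq hθ.sum_neg_cos_sq] at hreal
  rw [standardLambertCube, sphericalVolume_sphericalPolyhedron, hreal]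
  congr 1
  ring

end SphericalVolume

section RationalPythagorean

theorem IsObtusePythagorean.isRationalPythagoreanLambertCube {θ : Fin 3 → ℝ}
    (hθ : IsObtusePythagorean θ) (hrat : ∀ i, IsRationalAngle (θ i)) :
    IsRationalPythagoreanLambertCube (θ 0) (θ 1) (θ 2) (standardLambertCube θ) :=
  ⟨hθ.isLambertCube_standardLambertCube, hrat 0, hrat 1, hrat 2,
    by rw [← hθ.sum_cos_sq, Fin.sum_univ_three]⟩

namespace IsRationalPythagoreanLambertCube

variable {a b c : ℝ} {P : Set ℝ⁴}

theorem isObtusePythagorean_and_congruent (h : IsRationalPythagoreanLambertCube a b c P) :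
    IsObtusePythagorean ![a, b, c] ∧ SphericallyCongruent P (standardLambertCube ![a, b, c]) :=
  IsLambertCube.isObtusePythagorean_and_congruent (θ := ![a, b, c]) h.1
    ((Fin.sum_univ_three _).trans h.2.2.2.2)

theorem multiset_cases (h : IsRationalPythagoreanLambertCube a b c P) :
    ({a, b, c} : Multiset ℝ) = {3 * π / 4, 2 * π / 3, 2 * π / 3} ∨
      ({a, b, c} : Multiset ℝ) = {2 * π / 3, 3 * π / 5, 4 * π / 5} := by
  have hobtuse := h.isObtusePythagorean_and_congruent.1.mem_Ioo
  obtain ⟨-, ha, hb, hc, hsum⟩ := h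
  exact ha.obtuse_pythagorean_cases hb hc (hobtuse 0) (hobtuse 1) (hobtuse 2) hsum

theorem of_multiset_eq {a' b' c' : ℝ} (h : IsRationalPythagoreanLambertCube a b c P)
    (habc : ({a, b, c} : Multiset ℝ) = {a', b', c'}) :
    IsRationalPythagoreanLambertCube a' b' c' P := by
  obtain ⟨hcube, ha, hb, hc, hsum⟩ := h
  have hrat : ∀ x ∈ ({a', b', c'} : Multiset ℝ), IsRationalAngle x := by
    rw [← habc]
    simpa using ⟨ha, hb, hc⟩
  have hcos := congrArg (fun s : Multiset ℝ => (s.map fun x => Real.cos x ^ 2).sum) habc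
  simp only [Multiset.insert_eq_cons, Multiset.map_cons, Multiset.map_singleton,
    Multiset.sum_cons, Multiset.sum_singleton] at hcos
  exact ⟨hcube.of_multiset_eq habc, hrat _ (by simp), hrat _ (by simp), hrat _ (by simp),
    by linarith⟩

theorem of_congruent {Q : Set ℝ⁴} (h : IsRationalPythagoreanLambertCube a b c P)
    (hPQ : SphericallyCongruent P Q) : IsRationalPythagoreanLambertCube a b c Q :=
  ⟨h.1.of_congruent hPQ, h.2⟩

end IsRationalPythagoreanLambertCube

theorem isRationalPythagoreanLambertCube_and_multiset_eq_iff {a b c a' b' c' : ℝ} {P : Set ℝ⁴}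
    (h : IsRationalPythagoreanLambertCube a' b' c' (standardLambertCube ![a', b', c'])) :
    IsRationalPythagoreanLambertCube a b c P ∧ ({a, b, c} : Multiset ℝ) = {a', b', c'} ↔
      ({a, b, c} : Multiset ℝ) = {a', b', c'} ∧
        SphericallyCongruent P (standardLambertCube ![a', b', c']) :=
  ⟨fun hP => ⟨hP.2, (hP.1.of_multiset_eq hP.2).isObtusePythagorean_and_congruent.2⟩,
    fun hP => ⟨(h.of_multiset_eq hP.1.symm).of_congruent hP.2.symm, hP.1⟩⟩

theorem isObtusePythagorean_three_fourths :
    IsObtusePythagorean ![3 * π / 4, 2 * π / 3, 2 * π / 3] where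
  mem_Ioo i := by fin_cases i <;> constructor <;> simp <;> linarith [Real.pi_pos]
  sum_cos_sq := by
    simp only [Fin.sum_univ_three, Matrix.cons_val, cos_three_mul_pi_div_four,
      cos_two_mul_pi_div_three]
    linear_combination Real.sq_sqrt (show (0 : ℝ) ≤ 2 by norm_num) / 4

theorem isObtusePythagorean_three_fifths :
    IsObtusePythagorean ![2 * π / 3, 3 * π / 5, 4 * π / 5] where
  mem_Ioo i := by fin_cases i <;> constructor <;> simp <;> linarith [Real.pi_pos]
  sum_cos_sq := by
    simp only [Fin.sum_univ_three, Matrix.cons_val, cos_two_mul_pi_div_three,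
      cos_three_mul_pi_div_five, cos_four_mul_pi_div_five]
    linear_combination Real.sq_sqrt (show (0 : ℝ) ≤ 5 by norm_num) / 8

theorem isRationalPythagoreanLambertCube_three_fourths : IsRationalPythagoreanLambertCube
    (3 * π / 4) (2 * π / 3) (2 * π / 3) (standardLambertCube ![3 * π / 4, 2 * π / 3, 2 * π / 3]) :=
  isObtusePythagorean_three_fourths.isRationalPythagoreanLambertCube fun i =>
    ⟨![3 / 4, 2 / 3, 2 / 3] i, by fin_cases i <;> simp <;> ring⟩

theorem isRationalPythagoreanLambertCube_three_fifths : IsRationalPythagoreanLambertCube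
    (2 * π / 3) (3 * π / 5) (4 * π / 5) (standardLambertCube ![2 * π / 3, 3 * π / 5, 4 * π / 5]) :=
  isObtusePythagorean_three_fifths.isRationalPythagoreanLambertCube fun i =>
    ⟨![2 / 3, 3 / 5, 4 / 5] i, by fin_cases i <;> simp <;> ring⟩

theorem sphericalVolume_standardLambertCube_three_fourths :
    sphericalVolume (standardLambertCube ![3 * π / 4, 2 * π / 3, 2 * π / 3]) =
      ENNReal.ofReal (31 * π ^ 2 / 576) := by
  rw [isObtusePythagorean_three_fourths.sphericalVolume_standardLambertCube]
  congr 1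
  simp only [Fin.sum_univ_three, Matrix.cons_val]
  ring

theorem sphericalVolume_standardLambertCube_three_fifths :
    sphericalVolume (standardLambertCube ![2 * π / 3, 3 * π / 5, 4 * π / 5]) =
      ENNReal.ofReal (17 * π ^ 2 / 360) := by
  rw [isObtusePythagorean_three_fifths.sphericalVolume_standardLambertCube]
  congr 1
  simp only [Fin.sum_univ_three, Matrix.cons_val]
  ring

theorem not_sphericallyCongruent_of_sphericalVolume_ne {P Q : Set ℝ⁴} (hP : MeasurableSet P)
    (hvol : sphericalVolume P ≠ sphericalVolume Q) : ¬ SphericallyCongruent P Q := by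
  rintro ⟨g, rfl⟩
  exact hvol (sphericalVolume_image g hP).symm

theorem not_sphericallyCongruent_three_fourths_three_fifths :
    ¬ SphericallyCongruent (standardLambertCube ![3 * π / 4, 2 * π / 3, 2 * π / 3])
      (standardLambertCube ![2 * π / 3, 3 * π / 5, 4 * π / 5]) := by
  refine not_sphericallyCongruent_of_sphericalVolume_ne (measurableSet_sphericalPolyhedron _) ?_
  rw [sphericalVolume_standardLambertCube_three_fourths,
    sphericalVolume_standardLambertCube_three_fifths, Ne,
    ENNReal.ofReal_eq_ofReal_iff (by positivity) (by positivity)]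
  have := sq_pos_of_pos Real.pi_pos
  intro h
  linarith

end RationalPythagorean

section ContinuousFamilies

theorem mapsTo_Icc_of_mapsTo_dense {X : Type*} [TopologicalSpace X] {f : ℝ → X} {a b : ℝ}
    (hab : a < b) (hf : ContinuousOn f (Set.Icc a b)) {D : Set ℝ} (hD : Dense D) {F : Set X}
    (hF : IsClosed F) (h : ∀ t ∈ Set.Icc a b, t ∈ D → f t ∈ F) :
    Set.MapsTo f (Set.Icc a b) F := by
  have hclosure : closure (Set.Ioo a b ∩ D) = Set.Icc a b := by
    rw [← closure_Ioo hab.ne]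
    exact (closure_mono Set.inter_subset_left).antisymm
      (closure_minimal (hD.open_subset_closure_inter isOpen_Ioo) isClosed_closure)
  have hmaps : Set.MapsTo f (Set.Ioo a b ∩ D) F := fun t ht =>
    h t (Set.Ioo_subset_Icc_self ht.1) ht.2
  have := hmaps.closure_of_continuousOn (by rwa [hclosure])
  rwa [hclosure, hF.closure_eq] at this

theorem subsingleton_image_of_mapsTo_finite {X Y : Type*} [TopologicalSpace X]
    [TopologicalSpace Y] [T1Space Y] {f : X → Y} {s : Set X} {F : Set Y} (hs : IsPreconnected s)
    (hf : ContinuousOn f s) (hF : F.Finite) (h : Set.MapsTo f s F) : (f '' s).Subsingleton := by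
  by_contra hnontrivial
  exact (hs.image f hf).infinite_of_nontrivial (Set.not_subsingleton_iff.1 hnontrivial)
    (hF.subset h.image_subset)

theorem dense_setOf_isRationalAngle : Dense {t : ℝ | IsRationalAngle t} := by
  have hrange : DenseRange fun q : ℚ => (q : ℝ) * π :=
    (Homeomorph.mulRight₀ π Real.pi_ne_zero).surjective.denseRange.comp Rat.denseRange_cast
      (Homeomorph.mulRight₀ π Real.pi_ne_zero).continuous
  refine hrange.mono ?_
  rintro _ ⟨q, rfl⟩
  exact ⟨q, rfl⟩

theorem finite_setOf_triple_eq {α : Type*} (s : Multiset α) :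
    {p : α × α × α | ({p.1, p.2.1, p.2.2} : Multiset α) = s}.Finite := by
  have hs : {x | x ∈ s}.Finite := by
    classical
    exact s.toFinset.finite_toSet.subset fun x hx => Multiset.mem_toFinset.2 hx
  refine (hs.prod (hs.prod hs)).subset ?_
  rintro ⟨x, y, z⟩ rfl
  simp

theorem eq_of_isRationalPythagoreanLambertCube {γ : ℝ → ℝ × ℝ × ℝ} {t₀ t₁ : ℝ} (ht : t₀ < t₁)
    (hγ : ContinuousOn γ (Set.Icc t₀ t₁)) (h : ∀ t ∈ Set.Icc t₀ t₁, IsRationalAngle t →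
      ∃ P, IsRationalPythagoreanLambertCube (γ t).1 (γ t).2.1 (γ t).2.2 P)
    {t : ℝ} (htmem : t ∈ Set.Icc t₀ t₁) : γ t = γ t₀ := by
  have hfinite := (finite_setOf_triple_eq {3 * π / 4, 2 * π / 3, 2 * π / 3}).union
    (finite_setOf_triple_eq {2 * π / 3, 3 * π / 5, 4 * π / 5})
  have hmaps := mapsTo_Icc_of_mapsTo_dense ht hγ dense_setOf_isRationalAngle hfinite.isClosed
    fun t ht hrat => (h t ht hrat).elim fun _ hP => hP.multiset_cases
  exact subsingleton_image_of_mapsTo_finite isPreconnected_Icc hγ hfinite hmaps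
    ⟨t, htmem, rfl⟩ ⟨t₀, Set.left_mem_Icc.2 ht.le, rfl⟩

end ContinuousFamilies


theorem mainTheorem3 :
    -- there are exactly two such cubes up to isometry
    (∃ L₁ L₂ : Set (EuclideanSpace ℝ (Fin 4)),
      IsRationalPythagoreanLambertCube
        (3 * Real.pi / 4) (2 * Real.pi / 3) (2 * Real.pi / 3) L₁ ∧
      IsRationalPythagoreanLambertCube
        (2 * Real.pi / 3) (3 * Real.pi / 5) (4 * Real.pi / 5) L₂ ∧
      ¬ SphericallyCongruent L₁ L₂ ∧
      (∀ (a b c : ℝ) (P : Set (EuclideanSpace ℝ (Fin 4))),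
        IsRationalPythagoreanLambertCube a b c P ↔
          (({a, b, c} : Multiset ℝ) =
              {3 * Real.pi / 4, 2 * Real.pi / 3, 2 * Real.pi / 3} ∧
            SphericallyCongruent P L₁) ∨
          (({a, b, c} : Multiset ℝ) =
              {2 * Real.pi / 3, 3 * Real.pi / 5, 4 * Real.pi / 5} ∧
            SphericallyCongruent P L₂)) ∧
      sphericalVolume L₁ = ENNReal.ofReal (31 * Real.pi ^ 2 / 576) ∧
      sphericalVolume L₂ = ENNReal.ofReal (17 * Real.pi ^ 2 / 360)) ∧
    -- there is no nonconstant continuous family of them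
    (∀ (γ : ℝ → ℝ × ℝ × ℝ) (t₀ t₁ : ℝ), t₀ < t₁ → ContinuousOn γ (Set.Icc t₀ t₁) →
      (∀ t ∈ Set.Icc t₀ t₁, IsRationalAngle t →
        ∃ P, IsRationalPythagoreanLambertCube (γ t).1 (γ t).2.1 (γ t).2.2 P) →
      ∀ t ∈ Set.Icc t₀ t₁, γ t = γ t₀) := by
  have hiff₁ {a b c P} := isRationalPythagoreanLambertCube_and_multiset_eq_iff
    (a := a) (b := b) (c := c) (P := P) isRationalPythagoreanLambertCube_three_fourths
  have hiff₂ {a b c P} := isRationalPythagoreanLambertCube_and_multiset_eq_iff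
    (a := a) (b := b) (c := c) (P := P) isRationalPythagoreanLambertCube_three_fifths
  refine ⟨⟨_, _, isRationalPythagoreanLambertCube_three_fourths,
    isRationalPythagoreanLambertCube_three_fifths,
    not_sphericallyCongruent_three_fourths_three_fifths, fun a b c P => ?_,
    sphericalVolume_standardLambertCube_three_fourths,
    sphericalVolume_standardLambertCube_three_fifths⟩,
    fun _ _ _ ht hγ h _ => eq_of_isRationalPythagoreanLambertCube ht hγ h⟩
  rw [← hiff₁, ← hiff₂, ← and_or_left, iff_self_and]
  exact IsRationalPythagoreanLambertCube.multiset_cases
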